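/- **Setting.** Let $\rho$ be a probability distribution on a discrete prompt space $\mathcal X$ with $\rho(x)>0$ for all $x$. A policy $\pi$ assigns to each prompt $x$ a distribution $\pi(\cdot\mid x)$ on a discrete response space $\mathcal A$; the reference policy satisfies $\pi_{\mathsf{ref}}(a\mid x)>0$ for all $x,a$. Let $0<R_{\max}\le V_{\max}$, let $r^\star:\mathcal X\times\mathcal A\to[0,R_{\max}]$ be the true reward, $J(\pi)=\mathbb E_{x\sim\rho,\,a\sim\pi(\cdot\mid x)}[r^\star(x,a)]$, and, for a comparator policy $\pi^\star$, $\mathsf{SG}(\hat\pi;\pi^\star)=J(\pi^\star)-J(\hat\pi)$ and $\mathcal C^{\pi^\star}=\mathbb E_{x\sim\rho,\,a\sim\pi^\star(\cdot\mid x)}\big[\pi^\star(a\mid x)/\pi_{\mathsf{ref}}(a\mid x)\big]<\infty$. Put $\phi(u)=u+\log u$ (with $\phi(0)=-\infty$), $\sigma(z)=1/(1+e^{-z})$, $\operatorname{clip}_R(u)=\max\{\min\{u,R\},-R\}$. **Data.** For $i=1,\dots,n$ ($n\ge 1$) independently: $x_i\sim\rho$; $a_i^0,a_i^1\sim\pi_{\mathsf{ref}}(\cdot\mid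 x_i)$ independently; and the label $\bar y_i\in\{0,1\}$ is Huber-corrupted, i.e. drawn from $(1-\alpha)\,\mathrm{Ber}\big(\tfrac{e^{r^\star(x_i,a_i^1)}}{e^{r^\star(x_i,a_i^1)}+e^{r^\star(x_i,a_i^0)}}\big)+\alpha B_i$, where $\alpha\in[0,1/2]$ and $B_i$ is an arbitrary distribution on $\{0,1\}$, which may depend on $i$ and on $(x_i,a_i^0,a_i^1)$. **Algorithm.** Given a finite non-empty policy class $\Pi$, $\epsilon>0$, $\beta>0$ and a dataset $D=\{(x_i,a_i^0,a_i^1,\bar y_i)\}_{i\le n}$, set $$L(\pi;D)=\sum_{i=1}^n\Big[2\sigma\Big(\operatorname{clip}_{2R_{\max}}\Big[\beta\Big(\phi\Big(\tfrac{\pi(a_i^1\mid x_i)}{\pi_{\mathsf{ref}}(a_i^1\mid x_i)}\Big)-\phi\Big(\tfrac{\pi(a_i^0\mid x_i)}{\pi_{\mathsf{ref}}(a_i^0\mid x_i)}\Big)\Big)\Big]\Big)-1-(2\bar y_i-1)\Big]^2$$ and output $\hat\pi\in\Pi$ sampled with probability proportional to $\exp(-\tfrac{\epsilon}{8}L(\hat\pi;D))$.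 **Assumptions on $(\Pi,\beta)$.** (Realizability) $\Pi$ contains a maximizer, over all policies, of $J(\pi)-\beta\,[D_{\chi^2}(\pi\|\pi_{\mathsf{ref}})+D_{\mathsf{KL}}(\pi\|\pi_{\mathsf{ref}})]$, where $D_{\chi^2}(\pi\|\pi_{\mathsf{ref}})=\tfrac12\mathbb E_{x\sim\rho,\,a\sim\pi_{\mathsf{ref}}(\cdot\mid x)}\big[(\pi(a\mid x)/\pi_{\mathsf{ref}}(a\mid x)-1)^2\big]$ and $D_{\mathsf{KL}}(\pi\|\pi_{\mathsf{ref}})=\mathbb E_{x\sim\rho,\,a\sim\pi(\cdot\mid x)}\big[\log(\pi(a\mid x)/\pi_{\mathsf{ref}}(a\mid x))\big]$. (Bounded implicit reward difference) For all $\pi\in\Pi$, $x\in\mathcal X$, $a,b\in\mathcal A$: $\big|\beta\phi\big(\tfrac{\pi(a\mid x)}{\pi_{\mathsf{ref}}(a\mid x)}\big)-\beta\phi\big(\tfrac{\pi(b\mid x)}{\pi_{\mathsf{ref}}(b\mid x)}\big)\big|\le V_{\max}$. **Theorem.** (i) For every finite non-empty $\Pi$ and all $\epsilon,\beta>0$,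 the algorithm is $\epsilon$-differentially private: for any two datasets $D,D'$ that differ in one sample $(x_i,a_i^0,a_i^1,\bar y_i)$ and any set $S$ of outputs, $\mathbb P[\hat\pi(D)\in S]\le e^{\epsilon}\,\mathbb P[\hat\pi(D')\in S]$. (ii) There is a universal constant $c>0$ such that for all $\zeta\in(0,1]$, $\epsilon>0$, $\alpha\in[0,1/2]$ and $n\ge1$ and every comparator $\pi^\star$ there is a choice of $\beta>0$, depending only on $R_{\max},V_{\max},\epsilon,\zeta,\alpha,n,|\Pi|$ and $\mathcal C^{\pi^\star}$, such that whenever $\Pi$ satisfies the two assumptions with this $\beta$, then with probability at least $1-\zeta$ (over the corrupted data and the sampling step) the output satisfies $$\mathsf{SG}(\hat\pi;\pi^\star)\le c\,\kappa(\pi^\star)\left(\Big(1+\frac1{\sqrt\epsilon}\Big)\sqrt{\frac{\log(|\Pi|/\zeta)}{n}}+\sqrt\alpha\right),\qquad \kappa(\pi^\star)=e^{2R_{\max}}\,\frac{V_{\max}}{R_{\max}}\sqrt{\mathcal C^{\pi^\star}}.$$ -/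

import Mathlib

open scoped ENNReal

universe u v w

noncomputable section

namespace SquareChiPO

/-! ### Discrete probability -/

/-- The Bernoulli distribution with parameter `p`. -/
def ber (p : unitInterval) : PMF Bool :=
  PMF.ofFintype (fun b => cond b (ENNReal.ofReal p) (ENNReal.ofReal (1 - p))) (by
    rw [Fintype.sum_bool]
    simp only [cond_true, cond_false]
    rw [← ENNReal.ofReal_add p.2.1 (sub_nonneg.2 p.2.2)]
    simp)

theorem tsum_pi_prod {Z : Type w} :
    ∀ {n : ℕ} (p : Fin n → PMF Z), ∑' z : Fin n → Z, ∏ i, p i (z i) = 1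
  | 0, p => by simp
  | n + 1, p => by
    rw [← (Fin.consEquiv (fun _ : Fin (n + 1) => Z)).tsum_eq, ENNReal.tsum_prod']
    simp only [Fin.consEquiv, Equiv.coe_fn_mk, Fin.prod_univ_succ, Fin.cons_zero, Fin.cons_succ]
    simp only [ENNReal.tsum_mul_left, tsum_pi_prod (fun i => p (Fin.succ i)), mul_one,
      PMF.tsum_coe]

/-- The joint law of `n` independent samples, the `i`-th one with law `p i`. -/
def productPMF {Z : Type w} {n : ℕ} (p : Fin n → PMF Z) : PMF (Fin n → Z) :=
  ⟨fun z => ∏ i, p i (z i), ENNReal.summable.hasSum_iff.2 (tsum_pi_prod p)⟩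

/-- `prob q S` is the probability of the event `S` under `q`. -/
def prob {Ω : Type w} (q : PMF Ω) (S : Set Ω) : ℝ≥0∞ := q.toOuterMeasure S

/-- Pure `ε`-differential privacy of a randomized algorithm `M` run on `n` samples: the outputs on
any two datasets that differ in at most one sample are `exp ε`-indistinguishable. -/
def IsDP {Z : Type w} {Ω : Type*} {n : ℕ} (ε : ℝ) (M : (Fin n → Z) → PMF Ω) : Prop :=
  ∀ (D D' : Fin n → Z) (i : Fin n), (∀ j, j ≠ i → D j = D' j) →
    ∀ S : Set Ω, prob (M D) S ≤ ENNReal.ofReal (Real.exp ε) * prob (M D') S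

/-! ### Policies, rewards, divergences -/

/-- A (stochastic) policy: a distribution over responses for each prompt. -/
abbrev Policy (X : Type u) (A : Type v) := X → PMF A

variable {X : Type u} {A : Type v}

/-- `J(π) = E_{x ∼ ρ, a ∼ π(·|x)} [r x a]`. It is used for bounded `r` only. -/
def value (ρ : PMF X) (r : X → A → ℝ) (π : Policy X A) : ℝ :=
  ∑' x, (ρ x).toReal * ∑' a, (π x a).toReal * r x a

/-- Suboptimality gap `J(πstar) - J(πhat)`. -/
def gap (ρ : PMF X) (r : X → A → ℝ) (πstar πhat : Policy X A) : ℝ :=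
  value ρ r πstar - value ρ r πhat

/-- The density ratio `π(a|x) / πref(a|x)`. -/
def ratio (πref π : Policy X A) (x : X) (a : A) : ℝ≥0∞ := π x a / πref x a

/-- `L₁`-concentrability `E_{x ∼ ρ, a ∼ π(·|x)} [π(a|x) / πref(a|x)]`, possibly infinite. -/
def concentrability (ρ : PMF X) (πref π : Policy X A) : ℝ≥0∞ :=
  ∑' x, ρ x * ∑' a, π x a * ratio πref π x a

/-- `χ²`-divergence `E_{x ∼ ρ} [(1/2) E_{a ∼ πref(·|x)} [(π(a|x)/πref(a|x) - 1)²]]`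
(for `πref` of full support). -/
def chiSqDiv (ρ : PMF X) (πref π : Policy X A) : ℝ≥0∞ :=
  ∑' x, ρ x * (2⁻¹ * ∑' a, πref x a * ENNReal.ofReal (((ratio πref π x a).toReal - 1) ^ 2))

/-- `KL`-divergence `E_{x ∼ ρ} [KL(π(·|x) ‖ πref(·|x))]`. -/
def klDivergence (ρ : PMF X) (πref π : Policy X A) : ℝ≥0∞ :=
  letI : MeasurableSpace A := ⊤
  ∑' x, ρ x * InformationTheory.klDiv (π x).toMeasure (πref x).toMeasure

/-- The mixed `χ²`-regularized objective; it is `-∞` where the divergences are infinite. -/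
def mixedObjective (ρ : PMF X) (r : X → A → ℝ) (πref : Policy X A) (β : ℝ) (π : Policy X A) :
    EReal :=
  (value ρ r π : EReal) -
    ((ENNReal.ofReal β * (chiSqDiv ρ πref π + klDivergence ρ πref π) : ℝ≥0∞) : EReal)

/-- `π` maximizes the mixed `χ²`-regularized objective over all policies. -/
def IsRegularizedOptimal (ρ : PMF X) (r : X → A → ℝ) (πref : Policy X A) (β : ℝ)
    (π : Policy X A) : Prop :=
  ∀ π' : Policy X A, mixedObjective ρ r πref β π' ≤ mixedObjective ρ r πref β π

/-- Policy realizability: the optimal policy of the regularized objective belongs to the class. -/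
def Realizable (ρ : PMF X) (r : X → A → ℝ) (πref : Policy X A) (β : ℝ)
    (F : Finset (Policy X A)) : Prop :=
  ∃ π ∈ F, IsRegularizedOptimal ρ r πref β π

/-- `φ(u) = u + log u`, with `φ(0) = -∞`. -/
def phi (t : ℝ≥0∞) : EReal := (t : EReal) + ENNReal.log t

/-- Bounded implicit reward difference. Since `φ(0) = -∞` and the absolute value of an infinite
(or undefined) difference is `∞`, it forces the policies of the class to have full support. -/
def BoundedImplicitReward (πref : Policy X A) (β Vmax : ℝ) (F : Finset (Policy X A)) : Prop :=
  ∀ π ∈ F, ∀ (x : X) (a b : A),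
    ((β : EReal) * phi (ratio πref π x a) - (β : EReal) * phi (ratio πref π x b)).abs
      ≤ ENNReal.ofReal Vmax

/-! ### Data -/

/-- A sample `(x, a⁰, a¹, y)`: prompt, two responses, preference label (`true` means that `a¹` is
preferred). -/
abbrev Sample (X : Type u) (A : Type v) := X × A × A × Bool

/-- Bradley-Terry probability that a response of reward `s` beats a response of reward `t`. -/
def btProb (s t : ℝ) : unitInterval :=
  ⟨Real.exp s / (Real.exp s + Real.exp t), by positivity,
    div_le_one_of_le₀ (le_add_of_nonneg_right (Real.exp_pos t).le) (by positivity)⟩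

/-- Huber corruption: the mixture `(1 - α) G + α B`. -/
def huber (α : unitInterval) (G B : PMF Bool) : PMF Bool :=
  (ber α).bind fun c => cond c B G

/-- Law of one sample with Huber-corrupted Bradley-Terry label; `B x a⁰ a¹` is the law of the bad
label. -/
def corruptedSample (ρ : PMF X) (πref : Policy X A) (r : X → A → ℝ) (α : unitInterval)
    (B : X → A → A → PMF Bool) : PMF (Sample X A) :=
  ρ.bind fun x => (πref x).bind fun a0 => (πref x).bind fun a1 =>
    (huber α (ber (btProb (r x a1) (r x a0))) (B x a0 a1)).map fun y => (x, a0, a1, y)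

/-- Law of the corrupted dataset: independent samples, with an arbitrary bad label distribution
for each of them. -/
def corruptedData {n : ℕ} (ρ : PMF X) (πref : Policy X A) (r : X → A → ℝ) (α : unitInterval)
    (B : Fin n → X → A → A → PMF Bool) : PMF (Fin n → Sample X A) :=
  productPMF fun i => corruptedSample ρ πref r α (B i)

/-! ### The algorithm -/

/-- `clip_R(u) = max (min u R) (-R)` for an extended real `u`. -/
def clip (R : ℝ) (t : EReal) : ℝ := (max (min t (R : EReal)) (-(R : EReal))).toReal

/-- `h(x, a⁰, a¹) = φ(π(a¹|x)/πref(a¹|x)) - φ(π(a⁰|x)/πref(a⁰|x))`. -/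
def hChiPO (πref π : Policy X A) (x : X) (a0 a1 : A) : EReal :=
  phi (ratio πref π x a1) - phi (ratio πref π x a0)

/-- The label in `{-1, 1}`. -/
def signLabel (y : Bool) : ℝ := cond y 1 (-1)

/-- The bounded square loss `L(π; D)`. -/
def squareLoss {n : ℕ} (πref : Policy X A) (Rmax β : ℝ) (D : Fin n → Sample X A)
    (π : Policy X A) : ℝ :=
  ∑ i, (2 * Real.sigmoid (clip (2 * Rmax)
      ((β : EReal) * hChiPO πref π (D i).1 (D i).2.1 (D i).2.2.1)) - 1
    - signLabel (D i).2.2.2) ^ 2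

/-- Exponential mechanism on a non-empty finite class: `P(π) ∝ exp (-(ε/8) L(π))`. -/
def expMechanism {P : Type w} (F : Finset P) (hF : F.Nonempty) (ε : ℝ) (L : P → ℝ) : PMF F :=
  PMF.normalize (fun π => ENNReal.ofReal (Real.exp (-(ε / 8) * L π)))
    (fun h => by
      obtain ⟨π, hπ⟩ := hF
      have h1 := ENNReal.tsum_eq_zero.1 h ⟨π, hπ⟩
      simp only [ENNReal.ofReal_eq_zero] at h1
      exact absurd (Real.exp_pos _) (not_lt.2 h1))
    (by
      rw [tsum_fintype]
      exact ENNReal.sum_ne_top.2 fun _ _ => ENNReal.ofReal_ne_top)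

/-- The central-model algorithm: the exponential mechanism with the bounded square loss. -/
def squareChiPO {n : ℕ} (πref : Policy X A) (Rmax β ε : ℝ) (F : Finset (Policy X A))
    (hF : F.Nonempty) (D : Fin n → Sample X A) : PMF F :=
  expMechanism F hF ε (squareLoss πref Rmax β D)

/-- `κ = exp (2 Rmax) · (Vmax / Rmax) · √C`. -/
def kappa (Rmax Vmax C : ℝ) : ℝ := Real.exp (2 * Rmax) * (Vmax / Rmax) * Real.sqrt C

end SquareChiPO

end

noncomputable section

namespace SquareChiPO

variable {X : Type u} {A : Type v}

/-! Privacy: every summand of the loss lies in [0, 4], so one sample moves the loss by at most 4,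
and the weight and the normaliser of the exponential mechanism each by a factor at most exp(ε/2).

Utility rests on four facts. The derivative of the mixed generator is φ - 1, so moving mass between
two responses shows that the regularized optimum has the true reward differences as implicit reward
differences (`IsRegularizedOptimal.reward_sub_eq`). By realizability, some policy of the class
therefore predicts exactly the Bayes label.

The excess square loss over the Bayes prediction has mean at least the squared prediction error, up
to a multiple of α, and its second moment is bounded by that same error. Hence its exponential
moment decays at the fast rate (`label_moment_le`). The output probabilities are themselves bounded
by exponentials of the excess loss, so one union bound over the class handles the data and the
sampling step together (`prob_predictionError_gt_le`).

On the relevant range the sigmoid has slope at least exp(-2 Rmax)/4, and clipping loses only a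
factor Vmax/Rmax, so a small prediction error T gives a small reward error (`abs_sub_le_of_clip`).

Finally, the χ² part of φ contributes a negative square of the output's density ratio. It absorbs
the cost of the output's own reward error, and only the coverage C of the comparator remains: gap ≤
error/β + 2βC + β (`regret_pointwise`, `ofReal_gap_le`). Taking β of order √(T/C) balances the
terms. -/

/-! ### Privacy of the exponential mechanism -/

/-- The exponential mechanism is stable under bounded changes of the loss. -/
theorem expMechanism_le_of_loss_close {P : Type w} {F : Finset P} (hF : F.Nonempty) {ε : ℝ}
    (hε : 0 ≤ ε) {L L' : P → ℝ} (h : ∀ π, |L π - L' π| ≤ 4) (π : F) :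
    expMechanism F hF ε L π ≤ ENNReal.ofReal (Real.exp ε) * expMechanism F hF ε L' π := by
  unfold expMechanism
  simp only [PMF.normalize_apply, tsum_fintype]
  -- A loss change of 4 costs exp(4 · ε/8) = exp(ε/2). This is used once for the weight and once,
  -- with the losses exchanged, for the normaliser.
  have key : ∀ (L₁ L₂ : P → ℝ), (∀ π, |L₁ π - L₂ π| ≤ 4) → ∀ π,
      ENNReal.ofReal (Real.exp (-(ε / 8) * L₁ π)) ≤
        ENNReal.ofReal (Real.exp (ε / 2)) * ENNReal.ofReal (Real.exp (-(ε / 8) * L₂ π)) := by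
    intro L₁ L₂ h π
    rw [← ENNReal.ofReal_mul (Real.exp_pos _).le, ← Real.exp_add]
    refine ENNReal.ofReal_le_ofReal (Real.exp_le_exp.2 ?_)
    nlinarith [(abs_le.1 (h π)).1, (abs_le.1 (h π)).2]
  have hsplit : ENNReal.ofReal (Real.exp ε) =
      ENNReal.ofReal (Real.exp (ε / 2)) * ENNReal.ofReal (Real.exp (ε / 2)) := by
    rw [← ENNReal.ofReal_mul (Real.exp_pos _).le, ← Real.exp_add, add_halves]
  set k := ENNReal.ofReal (Real.exp (ε / 2)) with hk
  have hk0 : k ≠ 0 := by simp [hk, Real.exp_pos]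
  have hkt : k ≠ ⊤ := ENNReal.ofReal_ne_top
  rw [hsplit, mul_mul_mul_comm]
  refine mul_le_mul' (key _ _ h _) ?_
  have hsum : (∑ π : F, ENNReal.ofReal (Real.exp (-(ε / 8) * L' π))) ≤
      k * ∑ π : F, ENNReal.ofReal (Real.exp (-(ε / 8) * L π)) := by
    rw [Finset.mul_sum]
    exact Finset.sum_le_sum fun π _ => key _ _ (fun π => by rw [abs_sub_comm]; exact h π) _
  calc (∑ π : F, ENNReal.ofReal (Real.exp (-(ε / 8) * L π)))⁻¹
      = k * (k * ∑ π : F, ENNReal.ofReal (Real.exp (-(ε / 8) * L π)))⁻¹ := by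
        rw [ENNReal.mul_inv (Or.inl hk0) (Or.inl hkt), ← mul_assoc, ENNReal.mul_inv_cancel hk0 hkt,
          one_mul]
    _ ≤ _ := by gcongr

/-- The centred prediction of the preference label made by the implicit reward of `π`. -/
def prediction (πref : Policy X A) (Rmax β : ℝ) (π : Policy X A) (x : X) (a0 a1 : A) : ℝ :=
  2 * Real.sigmoid (clip (2 * Rmax) ((β : EReal) * hChiPO πref π x a0 a1)) - 1

theorem abs_two_mul_sigmoid_sub_one_le (t : ℝ) : |2 * Real.sigmoid t - 1| ≤ 1 := by
  rw [abs_le]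
  constructor <;> linarith [Real.sigmoid_nonneg t, Real.sigmoid_le_one t]

theorem sq_sub_signLabel_mem {t : ℝ} (ht : |t| ≤ 1) (y : Bool) :
    0 ≤ (t - signLabel y) ^ 2 ∧ (t - signLabel y) ^ 2 ≤ 4 := by
  rw [abs_le] at ht
  refine ⟨sq_nonneg _, ?_⟩
  cases y <;> simp only [signLabel, cond_true, cond_false] <;> nlinarith

theorem squareLoss_eq {n : ℕ} (πref : Policy X A) (Rmax β : ℝ) (D : Fin n → Sample X A)
    (π : Policy X A) : squareLoss πref Rmax β D π =
      ∑ i, (prediction πref Rmax β π (D i).1 (D i).2.1 (D i).2.2.1 -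
        signLabel (D i).2.2.2) ^ 2 := rfl

/-- Only the i-th summand changes, and it stays in [0, 4] because prediction and label lie in [-1,
1]. -/
theorem abs_squareLoss_sub_le {n : ℕ} (πref : Policy X A) (Rmax β : ℝ)
    {D D' : Fin n → Sample X A} (i : Fin n) (h : ∀ j, j ≠ i → D j = D' j) (π : Policy X A) :
    |squareLoss πref Rmax β D π - squareLoss πref Rmax β D' π| ≤ 4 := by
  rw [squareLoss_eq, squareLoss_eq, ← Finset.sum_sub_distrib, Finset.sum_eq_single i]
  · have h1 := sq_sub_signLabel_mem (abs_two_mul_sigmoid_sub_one_le (clip (2 * Rmax)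
      ((β : EReal) * hChiPO πref π (D i).1 (D i).2.1 (D i).2.2.1))) (D i).2.2.2
    have h2 := sq_sub_signLabel_mem (abs_two_mul_sigmoid_sub_one_le (clip (2 * Rmax)
      ((β : EReal) * hChiPO πref π (D' i).1 (D' i).2.1 (D' i).2.2.1))) (D' i).2.2.2
    rw [abs_le]
    unfold prediction
    constructor <;> linarith [h1.1, h1.2, h2.1, h2.2]
  · intro j _ hj
    rw [h j hj, sub_self]
  · simp

theorem squareChiPO_isDP {n : ℕ} (πref : Policy X A) (Rmax β : ℝ) {ε : ℝ}
    (F : Finset (Policy X A)) (hF : F.Nonempty) (hε : 0 < ε) :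
    IsDP ε (fun D : Fin n → Sample X A => squareChiPO πref Rmax β ε F hF D) := by
  intro D D' i h S
  unfold prob
  rw [PMF.toOuterMeasure_apply, PMF.toOuterMeasure_apply, ← ENNReal.tsum_mul_left]
  refine ENNReal.tsum_le_tsum fun π => ?_
  by_cases hπ : π ∈ S
  · simp only [Set.indicator_of_mem hπ]
    exact expMechanism_le_of_loss_close hF hε.le (abs_squareLoss_sub_le πref Rmax β i h) π
  · simp [Set.indicator_of_notMem hπ]

/-! ### The first-order condition for the regularized optimum -/

theorem tsum_eq_add_add_tsum {f : A → ℝ≥0∞} {a b : A} (hab : a ≠ b) :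
    ∑' c, f c = f a + f b + ∑' c, open Classical in if c = a ∨ c = b then 0 else f c := by
  classical
  rw [ENNReal.tsum_eq_add_tsum_ite a, ENNReal.tsum_eq_add_tsum_ite b, ← add_assoc]
  simp only [if_neg hab.symm]
  congr 1
  refine tsum_congr fun c => ?_
  by_cases ha : c = a <;> by_cases hb : c = b <;> simp [ha, hb]

/-- Move the mass `t` from `b` to `a`. -/
def shiftMass (p : PMF A) {a b : A} (hab : a ≠ b) {t : ℝ} (ha : -(p a).toReal ≤ t)
    (hb : t ≤ (p b).toReal) : PMF A :=
  ⟨open Classical in fun c => if c = a then ENNReal.ofReal ((p a).toReal + t) else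
      if c = b then ENNReal.ofReal ((p b).toReal - t) else p c, by
    classical
    refine ENNReal.summable.hasSum_iff.2 ?_
    rw [← p.tsum_coe, tsum_eq_add_add_tsum hab, tsum_eq_add_add_tsum (f := p) hab]
    congr 1
    · simp only [if_true, if_neg hab.symm]
      rw [← ENNReal.ofReal_add (by linarith) (by linarith), ← ENNReal.ofReal_toReal (p.apply_ne_top a),
        ← ENNReal.ofReal_toReal (p.apply_ne_top b),
        ← ENNReal.ofReal_add ENNReal.toReal_nonneg ENNReal.toReal_nonneg]
      congr 1
      simp
    · refine tsum_congr fun c => ?_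
      by_cases ha : c = a <;> by_cases hb : c = b <;> simp [ha, hb]⟩

section shiftMass
variable (p : PMF A) {a b : A} (hab : a ≠ b) {t : ℝ} (ha : -(p a).toReal ≤ t)
    (hb : t ≤ (p b).toReal)

theorem shiftMass_left : shiftMass p hab ha hb a = ENNReal.ofReal ((p a).toReal + t) :=
  if_pos rfl

theorem shiftMass_right : shiftMass p hab ha hb b = ENNReal.ofReal ((p b).toReal - t) :=
  (if_neg hab.symm).trans (if_pos rfl)

theorem shiftMass_of_ne {c : A} (hca : c ≠ a) (hcb : c ≠ b) : shiftMass p hab ha hb c = p c :=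
  (if_neg hca).trans (if_neg hcb)

end shiftMass

/-! ### Sums of bounded functions against a discrete distribution -/

theorem summable_toReal (p : PMF A) : Summable fun a => (p a).toReal :=
  ENNReal.summable_toReal (by simp [p.tsum_coe])

theorem tsum_toReal (p : PMF A) : ∑' a, (p a).toReal = 1 := by
  rw [← ENNReal.tsum_toReal_eq fun a => p.apply_ne_top a, p.tsum_coe, ENNReal.toReal_one]

theorem summable_toReal_mul (p : PMF A) {f : A → ℝ} {M : ℝ} (hf : ∀ a, |f a| ≤ M) :
    Summable fun a => (p a).toReal * f a := by
  refine Summable.of_norm_bounded ((summable_toReal p).mul_right M) fun a => ?_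
  rw [Real.norm_eq_abs, abs_mul, abs_of_nonneg ENNReal.toReal_nonneg]
  exact mul_le_mul_of_nonneg_left (hf a) ENNReal.toReal_nonneg

theorem abs_tsum_toReal_mul_le (p : PMF A) {f : A → ℝ} {M : ℝ} (hf : ∀ a, |f a| ≤ M) :
    |∑' a, (p a).toReal * f a| ≤ M := by
  have h : ∀ a, |(p a).toReal * f a| ≤ (p a).toReal * M := fun a => by
    rw [abs_mul, abs_of_nonneg ENNReal.toReal_nonneg]
    exact mul_le_mul_of_nonneg_left (hf a) ENNReal.toReal_nonneg
  have := tsum_of_norm_bounded (f := fun a => (p a).toReal * f a)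
    ((summable_toReal p).mul_right M).hasSum h
  rwa [tsum_mul_right, tsum_toReal, one_mul, Real.norm_eq_abs] at this

theorem tsum_shiftMass_mul (p : PMF A) {a b : A} (hab : a ≠ b) {t : ℝ} (ha : -(p a).toReal ≤ t)
    (hb : t ≤ (p b).toReal) {f : A → ℝ} {M : ℝ} (hf : ∀ a, |f a| ≤ M) :
    ∑' c, (shiftMass p hab ha hb c).toReal * f c =
      ∑' c, (p c).toReal * f c + t * (f a - f b) := by
  classical
  have h := ((summable_toReal_mul p hf).hasSum.update a (((p a).toReal + t) * f a)).update b
    (((p b).toReal - t) * f b)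
  rw [Function.update_of_ne hab.symm] at h
  refine (HasSum.tsum_eq (f := fun c => (shiftMass p hab ha hb c).toReal * f c) ?_)
  convert h using 1
  · rfl
  · ext c
    by_cases hcb : c = b
    · subst hcb
      rw [Function.update_self, shiftMass_right, ENNReal.toReal_ofReal (by linarith)]
    · rw [Function.update_of_ne hcb]
      by_cases hca : c = a
      · subst hca
        rw [Function.update_self, shiftMass_left, ENNReal.toReal_ofReal (by linarith)]
      · rw [Function.update_of_ne hca, shiftMass_of_ne _ _ _ _ hca hcb]
  · ring

/-- Boundedness of `r` makes the outer series summable, so that `tsum` is a genuine sum and not its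
default value 0. -/
theorem value_update (ρ : PMF X) {r : X → A → ℝ} {M : ℝ} (hr : ∀ x a, |r x a| ≤ M)
    (π : Policy X A) (x : X) (q : PMF A) :
    value ρ r (open Classical in Function.update π x q) =
      value ρ r π + (ρ x).toReal * (∑' a, (q a).toReal * r x a - ∑' a, (π x a).toReal * r x a) := by
  classical
  have h := (summable_toReal_mul ρ (f := fun x => ∑' a, (π x a).toReal * r x a)
    (fun x => abs_tsum_toReal_mul_le (π x) (hr x))).hasSum.update x
      ((ρ x).toReal * ∑' a, (q a).toReal * r x a)
  unfold value
  refine (HasSum.tsum_eq ?_)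
  convert h using 1
  · rfl
  · ext y
    by_cases hy : y = x
    · subst hy
      simp
    · simp [Function.update_of_ne hy]
  · ring

/-! ### The two divergences as one discrete sum -/

/-- Since `q` charges every point, `p` has density p/q with respect to `q`. The form with `klFun`
has nonnegative terms, so no integrability is needed. -/
theorem klDiv_toMeasure_eq_tsum [MeasurableSpace A] [Countable A] [DiscreteMeasurableSpace A]
    (p q : PMF A) (hq : ∀ a, 0 < q a) :
    InformationTheory.klDiv p.toMeasure q.toMeasure =
      ∑' a, q a * ENNReal.ofReal (InformationTheory.klFun (p a / q a).toReal) := by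
  have hsing : ∀ (p : PMF A) (a : A), p.toMeasure {a} = p a := fun p a =>
    p.toMeasure_apply_singleton a (MeasurableSet.of_discrete)
  have hdens : p.toMeasure = q.toMeasure.withDensity (fun a => p a / q a) := by
    refine MeasureTheory.Measure.ext_of_singleton fun a => ?_
    rw [MeasureTheory.withDensity_apply _ (MeasurableSet.of_discrete),
      MeasureTheory.lintegral_singleton, hsing, hsing,
      ENNReal.div_mul_cancel (hq a).ne' (q.apply_ne_top a)]
  have hac : p.toMeasure.AbsolutelyContinuous q.toMeasure := by
    rw [hdens]
    exact MeasureTheory.withDensity_absolutelyContinuous _ _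
  rw [InformationTheory.klDiv_eq_lintegral_klFun, if_pos hac]
  have hrn : p.toMeasure.rnDeriv q.toMeasure =ᵐ[q.toMeasure] fun a => p a / q a := by
    conv_lhs => rw [hdens]
    exact MeasureTheory.Measure.rnDeriv_withDensity _ (Measurable.of_discrete)
  rw [MeasureTheory.lintegral_congr_ae (g := fun a =>
      ENNReal.ofReal (InformationTheory.klFun (p a / q a).toReal)) (by
    filter_upwards [hrn] with a ha
    rw [ha]), MeasureTheory.lintegral_countable']
  exact tsum_congr fun a => by rw [hsing, mul_comm]

theorem countable_of_full_support (q : PMF A) (hq : ∀ a, 0 < q a) : Countable A := by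
  have h := q.support_countable
  rwa [show q.support = Set.univ from Set.eq_univ_of_forall fun a =>
    (q.mem_support_iff a).2 (hq a).ne', Set.countable_univ_iff] at h

/-- The mixed `χ²` and `KL` generator: `G(u) = (u - 1)² / 2 + (u log u + 1 - u)`. -/
def mixedGen (u : ℝ) : ℝ := (u - 1) ^ 2 / 2 + InformationTheory.klFun u

theorem mixedGen_nonneg {u : ℝ} (hu : 0 ≤ u) : 0 ≤ mixedGen u :=
  add_nonneg (by positivity) (InformationTheory.klFun_nonneg hu)

/-- The derivative is φ(u) - 1, which is why φ defines the implicit reward; the constant cancels in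
differences. -/
theorem hasDerivAt_mixedGen {u : ℝ} (hu : u ≠ 0) :
    HasDerivAt mixedGen (u - 1 + Real.log u) u := by
  have h1 : HasDerivAt (fun u : ℝ => (u - 1) ^ 2 / 2) (u - 1) u := by
    have := (((hasDerivAt_id u).sub_const 1).pow 2).div_const 2
    simpa using this
  exact h1.add (InformationTheory.hasDerivAt_klFun hu)

/-- The mixed divergence at one prompt. -/
def mixedDiv (q p : PMF A) : ℝ≥0∞ :=
  ∑' a, q a * ENNReal.ofReal (mixedGen (p a / q a).toReal)

theorem chiSqDiv_add_klDivergence (ρ : PMF X) {πref : Policy X A} (h : ∀ x a, 0 < πref x a)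
    (π : Policy X A) :
    chiSqDiv ρ πref π + klDivergence ρ πref π = ∑' x, ρ x * mixedDiv (πref x) (π x) := by
  unfold chiSqDiv klDivergence
  rw [← ENNReal.tsum_add]
  refine tsum_congr fun x => ?_
  let _ : MeasurableSpace A := ⊤
  have _ : DiscreteMeasurableSpace A := ⟨fun _ => trivial⟩
  have := countable_of_full_support (πref x) (h x)
  rw [klDiv_toMeasure_eq_tsum _ _ (h x), ← mul_add, ← ENNReal.tsum_mul_left, ← ENNReal.tsum_add]
  congr 1
  refine tsum_congr fun a => ?_
  unfold ratio mixedGen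
  rw [ENNReal.ofReal_add (by positivity) (InformationTheory.klFun_nonneg ENNReal.toReal_nonneg),
    mul_add, div_eq_inv_mul (_ ^ 2), ENNReal.ofReal_mul (by norm_num),
    ENNReal.ofReal_inv_of_pos (by norm_num), ENNReal.ofReal_ofNat, mul_left_comm]

/-- Isolates the two atoms that a mass shift affects. The remainder `R` is common to all such `p'`,
and is finite because it is part of the divergence of `p`. -/
theorem exists_mixedDiv_eq_add {q p : PMF A} {a b : A} (hab : a ≠ b) (hfin : mixedDiv q p ≠ ⊤) :
    ∃ R : ℝ≥0∞, R ≠ ⊤ ∧ ∀ p' : PMF A, (∀ c, c ≠ a → c ≠ b → p' c = p c) →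
      mixedDiv q p' = q a * ENNReal.ofReal (mixedGen (p' a / q a).toReal) +
        q b * ENNReal.ofReal (mixedGen (p' b / q b).toReal) + R := by
  classical
  refine ⟨∑' c, if c = a ∨ c = b then 0 else q c * ENNReal.ofReal (mixedGen (p c / q c).toReal),
    ?_, fun p' h => ?_⟩
  · refine ne_top_of_le_ne_top hfin (ENNReal.tsum_le_tsum fun c => ?_)
    split_ifs
    · exact zero_le
    · exact le_rfl
  · unfold mixedDiv
    rw [tsum_eq_add_add_tsum hab]
    congr 1
    refine tsum_congr fun c => ?_
    by_cases hc : c = a ∨ c = b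
    · simp [hc]
    · rw [if_neg hc, if_neg hc, h c (fun h => hc (Or.inl h)) (fun h => hc (Or.inr h))]

/-! ### Perturbation of the regularized optimum -/

section optimal
variable {ρ : PMF X} {πref π : Policy X A} {r : X → A → ℝ} {β : ℝ}

theorem mixedObjective_eq_coe (hβ : 0 ≤ β) (h : chiSqDiv ρ πref π + klDivergence ρ πref π ≠ ⊤) :
    mixedObjective ρ r πref β π = ((value ρ r π -
      β * (chiSqDiv ρ πref π + klDivergence ρ πref π).toReal : ℝ) : EReal) := by
  unfold mixedObjective
  rw [EReal.coe_sub, ← EReal.coe_ennreal_toReal (ENNReal.mul_ne_top ENNReal.ofReal_ne_top h),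
    ENNReal.toReal_mul, ENNReal.toReal_ofReal hβ]

/-- The competitor `πref` has zero divergence and a finite objective, whereas infinite divergence
would make the objective -∞. -/
theorem IsRegularizedOptimal.div_ne_top (hπ : IsRegularizedOptimal ρ r πref β π)
    (hβ : 0 < β) (href : ∀ x a, 0 < πref x a) :
    chiSqDiv ρ πref π + klDivergence ρ πref π ≠ ⊤ := by
  have h0 : chiSqDiv ρ πref πref + klDivergence ρ πref πref = 0 := by
    rw [chiSqDiv_add_klDivergence ρ href]
    refine ENNReal.tsum_eq_zero.2 fun x => ?_
    have : mixedDiv (πref x) (πref x) = 0 := ENNReal.tsum_eq_zero.2 fun a => by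
      rw [ENNReal.div_self (href x a).ne' ((πref x).apply_ne_top a)]
      simp [mixedGen, InformationTheory.klFun]
    rw [this, mul_zero]
  intro htop
  have h := hπ πref
  rw [mixedObjective_eq_coe hβ.le (by rw [h0]; exact ENNReal.zero_ne_top)] at h
  unfold mixedObjective at h
  rw [htop, ENNReal.mul_top (by simpa using hβ), EReal.coe_ennreal_top, EReal.sub_top] at h
  exact absurd h (not_le.2 (EReal.bot_lt_coe _))

theorem chiSqDiv_add_klDivergence_update (href : ∀ x a, 0 < πref x a) (x : X)
    (hx : 0 < ρ x) (h : chiSqDiv ρ πref π + klDivergence ρ πref π ≠ ⊤) :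
    mixedDiv (πref x) (π x) ≠ ⊤ ∧ ∃ R : ℝ≥0∞, R ≠ ⊤ ∧ ∀ q : PMF A,
      chiSqDiv ρ πref (open Classical in Function.update π x q) +
        klDivergence ρ πref (open Classical in Function.update π x q) =
        ρ x * mixedDiv (πref x) q + R := by
  classical
  rw [chiSqDiv_add_klDivergence ρ href] at h
  refine ⟨fun htop => ENNReal.ne_top_of_tsum_ne_top h x (by rw [htop, ENNReal.mul_top hx.ne']),
    ∑' y, if y = x then 0 else ρ y * mixedDiv (πref y) (π y), ?_, fun q => ?_⟩
  · refine ne_top_of_le_ne_top h (ENNReal.tsum_le_tsum fun y => ?_)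
    split_ifs
    · exact zero_le
    · exact le_rfl
  · rw [chiSqDiv_add_klDivergence ρ href, ENNReal.tsum_eq_add_tsum_ite x, Function.update_self]
    congr 1
    refine tsum_congr fun y => ?_
    split_ifs with hy
    · rfl
    · rw [Function.update_of_ne hy]

/-- The first-order condition: the implicit reward differences of the regularized optimum are the
true reward differences. -/
theorem IsRegularizedOptimal.reward_sub_eq (hπ : IsRegularizedOptimal ρ r πref β π)
    (hβ : 0 < β) (href : ∀ x a, 0 < πref x a) {M : ℝ} (hr : ∀ x a, |r x a| ≤ M) {x : X}
    (hx : 0 < ρ x) (hpos : ∀ a, 0 < π x a) (a b : A) :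
    r x a - r x b = β * (((ratio πref π x a).toReal + Real.log (ratio πref π x a).toReal) -
      ((ratio πref π x b).toReal + Real.log (ratio πref π x b).toReal)) := by
  classical
  rcases eq_or_ne a b with rfl | hab
  · simp
  have hfin := hπ.div_ne_top hβ href
  obtain ⟨hfinx, R, hR, hupd⟩ := chiSqDiv_add_klDivergence_update href x hx hfin
  obtain ⟨R', hR', hdiv⟩ := exists_mixedDiv_eq_add hab hfinx
  have hpa : 0 < (π x a).toReal := ENNReal.toReal_pos (hpos a).ne' ((π x).apply_ne_top a)
  have hpb : 0 < (π x b).toReal := ENNReal.toReal_pos (hpos b).ne' ((π x).apply_ne_top b)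
  have hqa : 0 < (πref x a).toReal := ENNReal.toReal_pos (href x a).ne' ((πref x).apply_ne_top a)
  have hqb : 0 < (πref x b).toReal := ENNReal.toReal_pos (href x b).ne' ((πref x).apply_ne_top b)
  have hρ : 0 < (ρ x).toReal := ENNReal.toReal_pos hx.ne' (ρ.apply_ne_top x)
  set pa := (π x a).toReal
  set pb := (π x b).toReal
  set qa := (πref x a).toReal
  set qb := (πref x b).toReal
  set w := (ρ x).toReal
  have hua : (ratio πref π x a).toReal = pa / qa := ENNReal.toReal_div _ _
  have hub : (ratio πref π x b).toReal = pb / qb := ENNReal.toReal_div _ _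
  -- the regularized objective along the perturbation, up to constants
  have hobj : ∀ t (ha : -pa ≤ t) (hb : t ≤ pb),
      mixedObjective ρ r πref β (Function.update π x (shiftMass (π x) hab ha hb)) =
        ((value ρ r π + w * (t * (r x a - r x b)) - β * (w * (qa * mixedGen ((pa + t) / qa) +
          qb * mixedGen ((pb - t) / qb) + R'.toReal) + R.toReal) : ℝ) : EReal) := by
    intro t ha hb
    have h1 := hdiv (shiftMass (π x) hab ha hb) fun c => shiftMass_of_ne (π x) hab ha hb
    rw [shiftMass_left, shiftMass_right, ENNReal.toReal_div, ENNReal.toReal_div,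
      ENNReal.toReal_ofReal (by linarith), ENNReal.toReal_ofReal (by linarith)] at h1
    have hga : 0 ≤ mixedGen ((pa + t) / qa) := mixedGen_nonneg (div_nonneg (by linarith) hqa.le)
    have hgb : 0 ≤ mixedGen ((pb - t) / qb) := mixedGen_nonneg (div_nonneg (by linarith) hqb.le)
    have hta : πref x a * ENNReal.ofReal (mixedGen ((pa + t) / qa)) ≠ ⊤ :=
      ENNReal.mul_ne_top ((πref x).apply_ne_top a) ENNReal.ofReal_ne_top
    have htb : πref x b * ENNReal.ofReal (mixedGen ((pb - t) / qb)) ≠ ⊤ :=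
      ENNReal.mul_ne_top ((πref x).apply_ne_top b) ENNReal.ofReal_ne_top
    have h1top : mixedDiv (πref x) (shiftMass (π x) hab ha hb) ≠ ⊤ := by
      rw [h1]
      exact ENNReal.add_ne_top.2 ⟨ENNReal.add_ne_top.2 ⟨hta, htb⟩, hR'⟩
    have h2top : ρ x * mixedDiv (πref x) (shiftMass (π x) hab ha hb) ≠ ⊤ :=
      ENNReal.mul_ne_top (ρ.apply_ne_top x) h1top
    rw [mixedObjective_eq_coe hβ.le (by rw [hupd]; exact ENNReal.add_ne_top.2 ⟨h2top, hR⟩), hupd,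
      ENNReal.toReal_add h2top hR, ENNReal.toReal_mul, h1,
      ENNReal.toReal_add (ENNReal.add_ne_top.2 ⟨hta, htb⟩) hR', ENNReal.toReal_add hta htb,
      ENNReal.toReal_mul, ENNReal.toReal_mul, ENNReal.toReal_ofReal hga, ENNReal.toReal_ofReal hgb,
      value_update ρ hr π x, tsum_shiftMass_mul (π x) hab ha hb (hr x), add_sub_cancel_left]
  have hself : Function.update π x (shiftMass (π x) hab (t := 0) (by linarith) hpb.le) = π := by
    rw [Function.update_eq_self_iff]
    ext c
    by_cases hca : c = a
    · subst hca
      rw [shiftMass_left, add_zero, ENNReal.ofReal_toReal ((π x).apply_ne_top c)]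
    by_cases hcb : c = b
    · subst hcb
      rw [shiftMass_right, sub_zero, ENNReal.ofReal_toReal ((π x).apply_ne_top c)]
    · rw [shiftMass_of_ne _ _ _ _ hca hcb]
  -- Both masses are positive, so small shifts of either sign are admissible. The constants drop
  -- out, and the factor `w`, the probability of the prompt, is divided out.
  have hmax : IsLocalMax (fun t : ℝ => t * (r x a - r x b) -
      β * (qa * mixedGen ((pa + t) / qa) + qb * mixedGen ((pb - t) / qb))) 0 := by
    filter_upwards [Ioo_mem_nhds (neg_lt_zero.2 hpa) hpb] with t ht
    have h := hπ (Function.update π x (shiftMass (π x) hab ht.1.le ht.2.le))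
    rw [hobj t ht.1.le ht.2.le] at h
    have h0 := hobj 0 (by linarith) hpb.le
    rw [hself] at h0
    rw [h0, EReal.coe_le_coe_iff] at h
    refine le_of_mul_le_mul_left ?_ hρ
    linarith
  have hderiv : HasDerivAt (fun t : ℝ => t * (r x a - r x b) -
      β * (qa * mixedGen ((pa + t) / qa) + qb * mixedGen ((pb - t) / qb)))
      ((r x a - r x b) - β * ((pa / qa - 1 + Real.log (pa / qa)) -
        (pb / qb - 1 + Real.log (pb / qb)))) 0 := by
    have hda : HasDerivAt (fun t : ℝ => (pa + t) / qa) (1 / qa) 0 :=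
      ((hasDerivAt_id (0 : ℝ)).const_add pa).div_const qa
    have hdb : HasDerivAt (fun t : ℝ => (pb - t) / qb) (-1 / qb) 0 :=
      ((hasDerivAt_id (0 : ℝ)).const_sub pb).div_const qb
    have hGa : HasDerivAt mixedGen (pa / qa - 1 + Real.log (pa / qa)) ((pa + 0) / qa) := by
      rw [add_zero]
      exact hasDerivAt_mixedGen (div_pos hpa hqa).ne'
    have hGb : HasDerivAt mixedGen (pb / qb - 1 + Real.log (pb / qb)) ((pb - 0) / qb) := by
      rw [sub_zero]
      exact hasDerivAt_mixedGen (div_pos hpb hqb).ne'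
    have h := ((hasDerivAt_id (0 : ℝ)).mul_const (r x a - r x b)).sub
      ((((hGa.comp (0 : ℝ) hda).const_mul qa).add ((hGb.comp (0 : ℝ) hdb).const_mul qb)).const_mul β)
    refine h.congr_deriv ?_
    field_simp
    ring
  have := hmax.hasDerivAt_eq_zero hderiv
  rw [hua, hub]
  linarith

end optimal

/-! ### Implicit rewards -/

/-- The finite value of `φ(π(a|x)/πref(a|x))`. -/
def realPhi (πref π : Policy X A) (x : X) (a : A) : ℝ :=
  (ratio πref π x a).toReal + Real.log (ratio πref π x a).toReal

theorem phi_eq_coe {t : ℝ≥0∞} (h0 : t ≠ 0) (ht : t ≠ ⊤) :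
    phi t = ((t.toReal + Real.log t.toReal : ℝ) : EReal) := by
  unfold phi
  rw [ENNReal.log_pos_real h0 ht, EReal.coe_add, EReal.coe_ennreal_toReal ht]

section implicit
variable {πref π : Policy X A} {β : ℝ}

theorem ratio_ne_top (href : ∀ x a, 0 < πref x a) (x : X) (a : A) : ratio πref π x a ≠ ⊤ :=
  ENNReal.div_ne_top ((π x).apply_ne_top a) (href x a).ne'

theorem phi_ratio_eq (href : ∀ x a, 0 < πref x a) {x : X} {a : A} (h : 0 < π x a) :
    phi (ratio πref π x a) = (realPhi πref π x a : EReal) :=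
  phi_eq_coe (ENNReal.div_pos h.ne' ((πref x).apply_ne_top a)).ne' (ratio_ne_top href x a)

/-- Already the case of equal responses forces positivity: a zero ratio gives ⊥ - ⊥ = ⊥ in `EReal`,
with absolute value ⊤. -/
theorem BoundedImplicitReward.pos {Vmax : ℝ} {F : Finset (Policy X A)}
    (h : BoundedImplicitReward πref β Vmax F) (hβ : 0 < β) (hπ : π ∈ F) (x : X) (a : A) :
    0 < π x a := by
  rw [pos_iff_ne_zero]
  intro h0
  have h1 := h π hπ x a a
  have h2 : phi (ratio πref π x a) = ⊥ := by
    unfold phi ratio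
    rw [h0, ENNReal.zero_div, ENNReal.log_zero, EReal.add_bot]
  rw [h2, EReal.coe_mul_bot_of_pos hβ, EReal.bot_sub] at h1
  simp at h1

theorem BoundedImplicitReward.abs_reward_sub_le {Vmax : ℝ} {F : Finset (Policy X A)}
    (h : BoundedImplicitReward πref β Vmax F) (hβ : 0 < β) (hV : 0 ≤ Vmax)
    (href : ∀ x a, 0 < πref x a) (hπ : π ∈ F) (x : X) (a b : A) :
    |β * (realPhi πref π x a - realPhi πref π x b)| ≤ Vmax := by
  have h1 := h π hπ x a b
  rw [phi_ratio_eq href (h.pos hβ hπ x a), phi_ratio_eq href (h.pos hβ hπ x b),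
    ← EReal.coe_mul, ← EReal.coe_mul, ← EReal.coe_sub, EReal.abs_def,
    ENNReal.ofReal_le_ofReal_iff hV] at h1
  rwa [mul_sub]

theorem clip_coe (R t : ℝ) : clip R (t : EReal) = max (min t R) (-R) := by
  unfold clip
  rw [← EReal.coe_neg, ← EReal.coe_strictMono.monotone.map_min,
    ← EReal.coe_strictMono.monotone.map_max, EReal.toReal_coe]

theorem prediction_eq (href : ∀ x a, 0 < πref x a) (Rmax : ℝ) {x : X} {a0 a1 : A}
    (h0 : 0 < π x a0) (h1 : 0 < π x a1) :
    prediction πref Rmax β π x a0 a1 = 2 * Real.sigmoid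
      (max (min (β * (realPhi πref π x a1 - realPhi πref π x a0)) (2 * Rmax)) (-(2 * Rmax))) - 1 := by
  unfold prediction hChiPO
  rw [phi_ratio_eq href h0, phi_ratio_eq href h1, ← EReal.coe_sub, ← EReal.coe_mul, clip_coe]

end implicit

/-! ### Inverting the sigmoid and the clipping -/

/-- The derivative equals 1/(2 + exp z + exp(-z)), and this denominator is at most 4 exp K. -/
theorem exp_neg_div_four_le_deriv_sigmoid {K z : ℝ} (hz : |z| ≤ K) :
    Real.exp (-K) / 4 ≤ Real.sigmoid z * (1 - Real.sigmoid z) := by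
  have hz' := abs_le.1 hz
  have h1 : Real.exp z ≤ Real.exp K := Real.exp_le_exp.2 hz'.2
  have h2 : Real.exp (-z) ≤ Real.exp K := Real.exp_le_exp.2 (by linarith)
  have h3 : 1 ≤ Real.exp K := Real.one_le_exp (by linarith)
  have hz0 := Real.exp_pos z
  have e : Real.sigmoid z * (1 - Real.sigmoid z) = 1 / (2 + Real.exp z + Real.exp (-z)) := by
    rw [← Real.sigmoid_neg, Real.sigmoid_def, Real.sigmoid_def, neg_neg, Real.exp_neg]
    field_simp
    ring
  rw [e, Real.exp_neg K, inv_eq_one_div, div_div]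
  exact one_div_le_one_div_of_le (by positivity) (by linarith)

theorem abs_sub_le_sigmoid {K s t : ℝ} (hs : |s| ≤ K) (ht : |t| ≤ K) :
    |s - t| ≤ 4 * Real.exp K * |Real.sigmoid s - Real.sigmoid t| := by
  have key : ∀ s ∈ Set.Icc (-K) K, ∀ t ∈ Set.Icc (-K) K, s ≤ t →
      Real.exp (-K) / 4 * (t - s) ≤ Real.sigmoid t - Real.sigmoid s := by
    refine (convex_Icc (-K) K).mul_sub_le_image_sub_of_le_deriv
      continuous_sigmoid.continuousOn differentiable_sigmoid.differentiableOn ?_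
    intro z hz
    rw [Real.deriv_sigmoid]
    exact exp_neg_div_four_le_deriv_sigmoid (abs_le.2 (Set.mem_Icc.1 (interior_subset hz)))
  have key' : ∀ {s t}, |s| ≤ K → |t| ≤ K → s ≤ t →
      |s - t| ≤ 4 * Real.exp K * |Real.sigmoid s - Real.sigmoid t| := by
    intro s t hs ht hst
    have h := key s (abs_le.1 hs) t (abs_le.1 ht) hst
    have hσ := Real.sigmoid_monotone hst
    rw [abs_of_nonpos (by linarith), abs_of_nonpos (by linarith)]
    have h' := mul_le_mul_of_nonneg_left h (by positivity : 0 ≤ 4 * Real.exp K)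
    have e : 4 * Real.exp K * (Real.exp (-K) / 4 * (t - s)) = t - s := by
      rw [Real.exp_neg]
      field_simp
    linarith
  rcases le_total s t with h | h
  · exact key' hs ht h
  · rw [abs_sub_comm, abs_sub_comm (Real.sigmoid s)]
    exact key' ht hs h

/-- Undoing the clipping and the sigmoid: an error in the prediction controls the error in the
reward difference. -/
theorem abs_sub_le_of_clip {R V d e : ℝ} (hR : 0 < R) (hRV : R ≤ V) (hd : |d| ≤ V) (he : |e| ≤ R) :
    |e - d| ≤ 4 * Real.exp (2 * R) * (V / R) *
      |(2 * Real.sigmoid (max (min d (2 * R)) (-(2 * R))) - 1) - (2 * Real.sigmoid e - 1)| := by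
  set k := max (min d (2 * R)) (-(2 * R)) with hk
  have hkR : |k| ≤ 2 * R :=
    abs_le.2 ⟨le_max_right _ _, max_le (min_le_right _ _) (by linarith)⟩
  have hσ := abs_sub_le_sigmoid (K := 2 * R) (s := e) (t := k) (he.trans (by linarith)) hkR
  have hVR : 1 ≤ V / R := (one_le_div hR).2 hRV
  -- Clipping at 2R rather than R leaves a margin: if it is active, then |e - k| ≥ R while |e - d| ≤
  -- 2V. If it is inactive, then k = d and V/R ≥ 1 suffices.
  have hclip : |e - d| ≤ 2 * (V / R) * |e - k| := by
    rw [abs_le] at hd he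
    have hge : R ≤ |e - k| → |e - d| ≤ 2 * (V / R) * |e - k| := fun h => by
      calc |e - d| ≤ 2 * V := abs_le.2 ⟨by linarith, by linarith⟩
        _ = 2 * (V / R) * R := by field_simp
        _ ≤ _ := by gcongr
    rcases lt_or_ge (2 * R) d with h1 | h1
    · refine hge ?_
      have : k = 2 * R := by rw [hk, min_eq_right h1.le, max_eq_left (by linarith)]
      rw [this, abs_sub_comm]
      exact le_trans (by linarith) (le_abs_self _)
    rcases lt_or_ge d (-(2 * R)) with h2 | h2
    · refine hge ?_
      have : k = -(2 * R) := by rw [hk, min_eq_left h1, max_eq_right h2.le]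
      rw [this]
      exact le_trans (by linarith) (le_abs_self _)
    · have : k = d := by rw [hk, min_eq_left h1, max_eq_left h2]
      rw [this]
      nlinarith [abs_nonneg (e - d)]
  have habs : |(2 * Real.sigmoid k - 1) - (2 * Real.sigmoid e - 1)| =
      2 * |Real.sigmoid e - Real.sigmoid k| := by
    rw [show (2 * Real.sigmoid k - 1) - (2 * Real.sigmoid e - 1) =
      2 * (Real.sigmoid k - Real.sigmoid e) by ring, abs_mul, abs_two, abs_sub_comm]
  rw [habs]
  calc |e - d| ≤ 2 * (V / R) * |e - k| := hclip
    _ ≤ 2 * (V / R) * (4 * Real.exp (2 * R) * |Real.sigmoid e - Real.sigmoid k|) := by gcongr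
    _ = _ := by ring

/-! ### The regret bound -/

/-- Passing to `ℝ≥0∞` removes the need for `h` to be summable: otherwise the right side is ⊤. -/
theorem ofReal_le_tsum_ofReal {ι : Type*} {f h : ι → ℝ} {s : ℝ} (hf : HasSum f s)
    (hfh : ∀ i, f i ≤ h i) (h0 : ∀ i, 0 ≤ h i) :
    ENNReal.ofReal s ≤ ∑' i, ENNReal.ofReal (h i) := by
  by_cases htop : ∑' i, ENNReal.ofReal (h i) = ⊤
  · rw [htop]
    exact le_top
  · have hs : Summable h := by
      have := ENNReal.summable_toReal htop
      simpa only [ENNReal.toReal_ofReal (h0 _)] using this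
    rw [← ENNReal.ofReal_tsum_of_nonneg h0 hs]
    exact ENNReal.ofReal_le_ofReal (hasSum_le hfh hf hs.hasSum)

/-- Here `u` and `v` are the density ratios of the comparator and of the output, and `d` is a reward
error. Young's inequality bounds -v·d at the price of βv²/2, and the term -βv²/2 from the χ² part of
φ cancels it. So no power of `v` survives, and the output needs no coverage. -/
theorem regret_pointwise {β u v d : ℝ} (hβ : 0 < β) (hu : 0 ≤ u) (hv : 0 < v) :
    (u - v) * (d + β * (v + Real.log v)) ≤ 1 / β * d ^ 2 + 2 * β * u ^ 2 + β := by
  -- From log v = log(v/u) + log u and log t ≤ t - 1, applied to both terms.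
  have hlog : u * Real.log v ≤ u ^ 2 - 2 * u + v := by
    rcases hu.eq_or_lt with rfl | hu
    · simpa using hv.le
    · have h1 := Real.log_le_sub_one_of_pos (div_pos hv hu)
      rw [Real.log_div hv.ne' hu.ne'] at h1
      have h2 := Real.log_le_sub_one_of_pos hu
      have h3 := mul_le_mul_of_nonneg_left (show Real.log v ≤ v / u - 1 + (u - 1) by linarith) hu.le
      have h4 : u * (v / u - 1 + (u - 1)) = u ^ 2 - 2 * u + v := by
        field_simp
        ring
      linarith
  have hlog' : 1 - 1 / v ≤ Real.log v := by simpa using Real.one_sub_inv_le_log_of_pos hv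
  have hlog'' : v - 1 ≤ v * Real.log v := by
    have := mul_le_mul_of_nonneg_left hlog' hv.le
    rwa [mul_sub, mul_one_div_cancel hv.ne', mul_one] at this
  have hreg : (u - v) * (v + Real.log v) ≤ 3 / 2 * u ^ 2 + 1 - v ^ 2 / 2 := by
    nlinarith [sq_nonneg (u - v)]
  have hyoung : ∀ w : ℝ, w * d ≤ 1 / β * d ^ 2 / 2 + β * w ^ 2 / 2 := fun w => by
    have h : 0 ≤ (d - β * w) ^ 2 / (2 * β) := by positivity
    have e : (d - β * w) ^ 2 / (2 * β) = 1 / β * d ^ 2 / 2 + β * w ^ 2 / 2 - w * d := by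
      field_simp
      ring
    linarith
  have h1 := hyoung u
  have h2 := hyoung (-v)
  have h3 := mul_le_mul_of_nonneg_left hreg hβ.le
  nlinarith

/-- Both `q` and `v` have total mass 1, so the constant `e b` may be subtracted from the reward for
any baseline response `b`. Then `regret_pointwise` is averaged under `p`. -/
theorem regret_prompt_le {p q v : PMF A} (hp : ∀ a, 0 < p a) (hv : ∀ a, 0 < v a) {r : A → ℝ}
    {M β : ℝ} (hr : ∀ a, |r a| ≤ M) (hβ : 0 < β) {e : A → ℝ}
    (he : ∀ a, e a = r a - β * ((v a / p a).toReal + Real.log (v a / p a).toReal)) (b : A) :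
    ENNReal.ofReal (∑' a, (q a).toReal * r a - ∑' a, (v a).toReal * r a) ≤
      ENNReal.ofReal (1 / β) * ∑' a, p a * ENNReal.ofReal ((e a - e b) ^ 2) +
        ENNReal.ofReal (2 * β) * ∑' a, q a * (q a / p a) + ENNReal.ofReal β := by
  have hsum : HasSum (fun a => ((q a).toReal - (v a).toReal) * (r a - e b))
      (∑' a, (q a).toReal * r a - ∑' a, (v a).toReal * r a) := by
    have hc : ∀ s : PMF A, HasSum (fun a => (s a).toReal * e b) (e b) := fun s => by
      have := ((summable_toReal s).hasSum.mul_right (e b))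
      rwa [tsum_toReal, one_mul] at this
    have h := ((summable_toReal_mul q hr).hasSum.sub (summable_toReal_mul v hr).hasSum).sub
      ((hc q).sub (hc v))
    rw [sub_self, sub_zero] at h
    convert h using 1
    · rfl
    · ext a
      ring
  refine (ofReal_le_tsum_ofReal (h := fun a => (p a).toReal * (1 / β * (e a - e b) ^ 2 +
    2 * β * (q a / p a).toReal ^ 2 + β)) hsum (fun a => ?_) fun a => by positivity).trans
      (le_of_eq ?_)
  · have hpa : 0 < (p a).toReal := ENNReal.toReal_pos (hp a).ne' (p.apply_ne_top a)
    have hva : 0 < (v a / p a).toReal := by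
      rw [ENNReal.toReal_div]
      exact div_pos (ENNReal.toReal_pos (hv a).ne' (v.apply_ne_top a)) hpa
    have h := regret_pointwise (d := e a - e b) hβ (ENNReal.toReal_nonneg (a := q a / p a)) hva
    have h' := mul_le_mul_of_nonneg_left h hpa.le
    refine le_trans (le_of_eq ?_) h'
    rw [show e a - e b + β * ((v a / p a).toReal + Real.log (v a / p a).toReal) = r a - e b by
      rw [he a]; ring, ENNReal.toReal_div, ENNReal.toReal_div]
    field_simp
  · have hterm : ∀ a, ENNReal.ofReal ((p a).toReal * (1 / β * (e a - e b) ^ 2 +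
        2 * β * (q a / p a).toReal ^ 2 + β)) =
        ENNReal.ofReal (1 / β) * (p a * ENNReal.ofReal ((e a - e b) ^ 2)) +
          ENNReal.ofReal (2 * β) * (q a * (q a / p a)) + p a * ENNReal.ofReal β := by
      intro a
      have hqp : q a = p a * (q a / p a) :=
        (ENNReal.mul_div_cancel (hp a).ne' (p.apply_ne_top a)).symm
      have htop : q a / p a ≠ ⊤ := ENNReal.div_ne_top (q.apply_ne_top a) (hp a).ne'
      rw [ENNReal.ofReal_mul ENNReal.toReal_nonneg, ENNReal.ofReal_toReal (p.apply_ne_top a),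
        ENNReal.ofReal_add (by positivity) hβ.le, ENNReal.ofReal_add (by positivity) (by positivity),
        ENNReal.ofReal_mul (by positivity), ENNReal.ofReal_mul (p := 2 * β) (by positivity),
        ENNReal.ofReal_pow ENNReal.toReal_nonneg, ENNReal.ofReal_toReal htop]
      rw [show q a * (q a / p a) = p a * (q a / p a) * (q a / p a) by rw [← hqp]]
      ring
    rw [tsum_congr hterm, ENNReal.tsum_add, ENNReal.tsum_add, ENNReal.tsum_mul_left,
      ENNReal.tsum_mul_left, ENNReal.tsum_mul_right, p.tsum_coe, one_mul]

theorem ofReal_gap_le {ρ : PMF X} {πref π πstar : Policy X A} (href : ∀ x a, 0 < πref x a)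
    (hπ : ∀ x a, 0 < π x a) {r : X → A → ℝ} {M β : ℝ} (hr : ∀ x a, |r x a| ≤ M) (hβ : 0 < β) :
    ENNReal.ofReal (gap ρ r πstar π) ≤
      ENNReal.ofReal (1 / β) * (∑' x, ρ x * ∑' a0, πref x a0 * ∑' a1, πref x a1 *
        ENNReal.ofReal (((r x a1 - r x a0) -
          β * (realPhi πref π x a1 - realPhi πref π x a0)) ^ 2)) +
        ENNReal.ofReal (2 * β) * concentrability ρ πref πstar + ENNReal.ofReal β := by
  set g : X → ℝ := fun x => ∑' a, (πstar x a).toReal * r x a - ∑' a, (π x a).toReal * r x a with hg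
  have hgap : HasSum (fun x => (ρ x).toReal * g x) (gap ρ r πstar π) := by
    have h := (summable_toReal_mul ρ (fun x => abs_tsum_toReal_mul_le (πstar x) (hr x))).hasSum.sub
      (summable_toReal_mul ρ (fun x => abs_tsum_toReal_mul_le (π x) (hr x))).hasSum
    simp only [← mul_sub] at h
    exact h
  have hx : ∀ x, ENNReal.ofReal (g x) ≤
      ENNReal.ofReal (1 / β) * (∑' a0, πref x a0 * ∑' a1, πref x a1 *
        ENNReal.ofReal (((r x a1 - r x a0) -
          β * (realPhi πref π x a1 - realPhi πref π x a0)) ^ 2)) +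
        ENNReal.ofReal (2 * β) * ∑' a, πstar x a * ratio πref πstar x a + ENNReal.ofReal β := by
    intro x
    -- The bound holds for every baseline `b`; averaging over `b` drawn from `πref` produces the
    -- error on pairs of responses that the data measure.
    have hb : ∀ b, ENNReal.ofReal (g x) ≤ _ := fun b =>
      regret_prompt_le (href x) (hπ x) (q := πstar x) (hr x) hβ
        (e := fun a => r x a - β * realPhi πref π x a) (fun a => rfl) b
    calc ENNReal.ofReal (g x) = ∑' b, πref x b * ENNReal.ofReal (g x) := by
          rw [ENNReal.tsum_mul_right, (πref x).tsum_coe, one_mul]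
      _ ≤ _ := ENNReal.tsum_le_tsum fun b => mul_le_mul_right (hb b) _
      _ = _ := by
        simp only [mul_add]
        rw [ENNReal.tsum_add, ENNReal.tsum_add, ENNReal.tsum_mul_right, ENNReal.tsum_mul_right,
          (πref x).tsum_coe, one_mul, one_mul]
        congr 2
        rw [← ENNReal.tsum_mul_left]
        refine tsum_congr fun b => ?_
        rw [mul_left_comm]
        congr 2
        refine tsum_congr fun a => ?_
        congr 3
        ring
  calc ENNReal.ofReal (gap ρ r πstar π) ≤ ∑' x, ENNReal.ofReal ((ρ x).toReal * max (g x) 0) :=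
        ofReal_le_tsum_ofReal hgap
          (fun x => mul_le_mul_of_nonneg_left (le_max_left _ _) ENNReal.toReal_nonneg)
          fun x => mul_nonneg ENNReal.toReal_nonneg (le_max_right _ _)
    _ = ∑' x, ρ x * ENNReal.ofReal (g x) := tsum_congr fun x => by
        rw [ENNReal.ofReal_mul ENNReal.toReal_nonneg, ENNReal.ofReal_toReal (ρ.apply_ne_top x),
          ENNReal.ofReal_max, ENNReal.ofReal_zero, max_eq_left zero_le]
    _ ≤ _ := ENNReal.tsum_le_tsum fun x => mul_le_mul_right (hx x) _
    _ = _ := by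
        simp only [mul_add]
        rw [ENNReal.tsum_add, ENNReal.tsum_add, ENNReal.tsum_mul_right, ρ.tsum_coe, one_mul]
        unfold concentrability
        rw [← ENNReal.tsum_mul_left, ← ENNReal.tsum_mul_left]
        simp only [mul_left_comm]

/-! ### Exponential moments of the excess loss -/

theorem tsum_bind_mul {S T : Type*} (p : PMF S) (f : S → PMF T) (h : T → ℝ≥0∞) :
    ∑' b, p.bind f b * h b = ∑' a, p a * ∑' b, f a b * h b := by
  simp only [PMF.bind_apply, ← ENNReal.tsum_mul_right, ← ENNReal.tsum_mul_left, mul_assoc]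
  exact ENNReal.tsum_comm

theorem tsum_map_mul {S T : Type*} (p : PMF S) (f : S → T) (h : T → ℝ≥0∞) :
    ∑' b, p.map f b * h b = ∑' a, p a * h (f a) := by
  classical
  rw [PMF.map, tsum_bind_mul]
  refine tsum_congr fun a => ?_
  rw [tsum_eq_single (f a) fun b hb => by simp [PMF.pure_apply, hb]]
  simp [PMF.pure_apply]

theorem tsum_pi_prod_eq_prod_tsum {Z : Type*} :
    ∀ {n : ℕ} (f : Fin n → Z → ℝ≥0∞), ∑' z : Fin n → Z, ∏ i, f i (z i) = ∏ i, ∑' z, f i z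
  | 0, f => by simp
  | n + 1, f => by
    rw [← (Fin.consEquiv (fun _ : Fin (n + 1) => Z)).tsum_eq, ENNReal.tsum_prod']
    simp only [Fin.consEquiv, Equiv.coe_fn_mk, Fin.prod_univ_succ, Fin.cons_zero, Fin.cons_succ]
    simp only [ENNReal.tsum_mul_left, tsum_pi_prod_eq_prod_tsum (fun i => f (Fin.succ i)),
      ENNReal.tsum_mul_right]

theorem tsum_ber_mul (p : unitInterval) (h : Bool → ℝ≥0∞) :
    ∑' b, ber p b * h b =
      ENNReal.ofReal p * h true + ENNReal.ofReal (1 - p) * h false := by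
  rw [tsum_fintype, Fintype.sum_bool]
  rfl

theorem exists_tsum_bool_mul (B : PMF Bool) : ∃ b : unitInterval, ∀ h : Bool → ℝ≥0∞,
    ∑' y, B y * h y = ENNReal.ofReal b * h true + ENNReal.ofReal (1 - b) * h false := by
  have hsum : (B true).toReal + (B false).toReal = 1 := by
    have := tsum_toReal B
    rwa [tsum_fintype, Fintype.sum_bool] at this
  have h1 : (B true).toReal ≤ 1 := by
    linarith [ENNReal.toReal_nonneg (a := B false)]
  refine ⟨⟨(B true).toReal, ENNReal.toReal_nonneg, h1⟩, fun h => ?_⟩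
  rw [tsum_fintype, Fintype.sum_bool, ENNReal.ofReal_toReal (B.apply_ne_top _),
    show 1 - (B true).toReal = (B false).toReal by linarith,
    ENNReal.ofReal_toReal (B.apply_ne_top _)]

theorem exp_le_one_add_add_sq {u : ℝ} (hu : |u| ≤ 1) : Real.exp u ≤ 1 + u + u ^ 2 := by
  linarith [(abs_le.1 (Real.abs_exp_sub_one_sub_id_le hu)).2]

/-- Conditional exponential moment of the excess loss of the prediction `f` over the Bayes
prediction `2 p - 1`, under a label that is corrupted with probability `α`. -/
theorem label_moment_le {f p α b s : ℝ} (hf : |f| ≤ 1) (hp : 0 ≤ p) (hp1 : p ≤ 1) (hα : 0 ≤ α)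
    (hα1 : α ≤ 1) (hb : 0 ≤ b) (hb1 : b ≤ 1) (hs : 0 ≤ s) (hs1 : s ≤ 1 / 32) :
    α * (b * Real.exp (-s * ((f - 1) ^ 2 - (2 * p - 1 - 1) ^ 2)) +
        (1 - b) * Real.exp (-s * ((f - -1) ^ 2 - (2 * p - 1 - -1) ^ 2))) +
      (1 - α) * (p * Real.exp (-s * ((f - 1) ^ 2 - (2 * p - 1 - 1) ^ 2)) +
        (1 - p) * Real.exp (-s * ((f - -1) ^ 2 - (2 * p - 1 - -1) ^ 2))) +
      s / 2 * (f - (2 * p - 1)) ^ 2 ≤ 1 + 8 * s * α := by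
  rw [abs_le] at hf
  obtain ⟨g, hg⟩ : ∃ g, g = f - (2 * p - 1) := ⟨_, rfl⟩
  have hg2 : |g| ≤ 2 := abs_le.2 ⟨by linarith, by linarith⟩
  -- The excess loss factors as W = g · (f + (2p - 1) - 2y) with second factor at most 4 in absolute
  -- value. So W² ≤ 16 g², and s ≤ 1/32 gives s²W² ≤ s g²/2.
  have hexp : ∀ y : ℝ, |y| ≤ 1 → Real.exp (-s * ((f - y) ^ 2 - (2 * p - 1 - y) ^ 2)) ≤
      1 - s * ((f - y) ^ 2 - (2 * p - 1 - y) ^ 2) + s / 2 * g ^ 2 := by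
    intro y hy
    rw [abs_le] at hy
    have hW : (f - y) ^ 2 - (2 * p - 1 - y) ^ 2 = g * (f + (2 * p - 1) - 2 * y) := by
      rw [hg]; ring
    have h4 : |f + (2 * p - 1) - 2 * y| ≤ 4 := abs_le.2 ⟨by linarith, by linarith⟩
    rw [hW]
    have hsq : (f + (2 * p - 1) - 2 * y) ^ 2 ≤ 16 := by
      have := sq_le_sq' (abs_le.1 h4).1 (abs_le.1 h4).2
      linarith
    have habs : |-s * (g * (f + (2 * p - 1) - 2 * y))| ≤ 1 := by
      rw [abs_mul, abs_mul, abs_neg, abs_of_nonneg hs]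
      calc s * (|g| * |f + (2 * p - 1) - 2 * y|) ≤ 1 / 32 * (2 * 4) := by gcongr
        _ ≤ 1 := by norm_num
    have h := exp_le_one_add_add_sq habs
    have hquad : (-s * (g * (f + (2 * p - 1) - 2 * y))) ^ 2 ≤ s / 2 * g ^ 2 := by
      calc (-s * (g * (f + (2 * p - 1) - 2 * y))) ^ 2
          = s * (s * (g ^ 2 * (f + (2 * p - 1) - 2 * y) ^ 2)) := by ring
        _ ≤ s * (1 / 32 * (g ^ 2 * 16)) := by gcongr
        _ = s / 2 * g ^ 2 := by ring
    linarith
  have h1 := hexp 1 (by norm_num)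
  have h0 := hexp (-1) (by norm_num)
  set w1 := Real.exp (-s * ((f - 1) ^ 2 - (2 * p - 1 - 1) ^ 2))
  set w0 := Real.exp (-s * ((f - -1) ^ 2 - (2 * p - 1 - -1) ^ 2))
  -- If the label is 1 with probability t, the mean excess loss is g² + 4g(p - t). It is exactly g²
  -- for clean labels, t = p; for bad labels the extra term is at least -8.
  have hmix : ∀ t : ℝ, 0 ≤ t → t ≤ 1 → t * w1 + (1 - t) * w0 ≤
      1 - s * (g ^ 2 + 4 * g * (p - t)) + s / 2 * g ^ 2 := by
    intro t ht ht1
    have e1 := mul_le_mul_of_nonneg_left h1 ht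
    have e0 := mul_le_mul_of_nonneg_left h0 (sub_nonneg.2 ht1)
    rw [hg] at e1 e0 ⊢
    linarith
  have hb' := mul_le_mul_of_nonneg_left (hmix b hb hb1) hα
  have hp' := mul_le_mul_of_nonneg_left (hmix p hp hp1) (sub_nonneg.2 hα1)
  have hgp : -(4 * g * (p - b)) ≤ 8 := by
    have h : |g * (p - b)| ≤ 2 * 1 := by
      rw [abs_mul]
      exact mul_le_mul hg2 (abs_le.2 ⟨by linarith, by linarith⟩) (abs_nonneg _) (by norm_num)
    linarith [(abs_le.1 h).1]
  have hαs := mul_le_mul_of_nonneg_left hgp (mul_nonneg hα hs)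
  rw [← hg]
  linarith

/-- Squared distance of a prediction to the Bayes prediction, under the uncorrupted law. -/
def predictionError (ρ : PMF X) (πref : Policy X A) (f g : X → A → A → ℝ) : ℝ≥0∞ :=
  ∑' x, ρ x * ∑' a0, πref x a0 * ∑' a1, πref x a1 *
    ENNReal.ofReal ((f x a0 a1 - g x a0 a1) ^ 2)

/-- The Bayes prediction of the uncorrupted label. -/
def bayesPrediction (r : X → A → ℝ) (x : X) (a0 a1 : A) : ℝ :=
  2 * (btProb (r x a1) (r x a0) : ℝ) - 1

theorem tsum_mul_le {S : Type*} (p : PMF S) {f : S → ℝ≥0∞} {K : ℝ≥0∞} (h : ∀ a, f a ≤ K) :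
    ∑' a, p a * f a ≤ K :=
  calc ∑' a, p a * f a ≤ ∑' a, p a * K := ENNReal.tsum_le_tsum fun a => mul_le_mul_right (h a) _
    _ = K := by rw [ENNReal.tsum_mul_right, p.tsum_coe, one_mul]

theorem abs_bayesPrediction_le (r : X → A → ℝ) (x : X) (a0 a1 : A) :
    |bayesPrediction r x a0 a1| ≤ 1 := by
  have h := (btProb (r x a1) (r x a0)).2
  unfold bayesPrediction
  exact abs_le.2 ⟨by linarith [h.1], by linarith [h.2]⟩

theorem predictionError_ne_top (ρ : PMF X) (πref : Policy X A) {f : X → A → A → ℝ}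
    (hf : ∀ x a0 a1, |f x a0 a1| ≤ 1) (r : X → A → ℝ) :
    predictionError ρ πref f (bayesPrediction r) ≠ ⊤ := by
  refine ne_top_of_le_ne_top (b := ENNReal.ofReal 4) ENNReal.ofReal_ne_top
    (tsum_mul_le _ fun x => tsum_mul_le _ fun a0 => tsum_mul_le _ fun a1 =>
      ENNReal.ofReal_le_ofReal ?_)
  have h1 := abs_le.1 (hf x a0 a1)
  have h2 := abs_le.1 (abs_bayesPrediction_le r x a0 a1)
  nlinarith

section moments
variable (ρ : PMF X) (πref : Policy X A) (r : X → A → ℝ) (α : unitInterval)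

/-- The error stands on the left as a summand, since subtraction in `ℝ≥0∞` is truncated and does not
pass through sums. In this form the conditional bound `label_moment_le` integrates directly. -/
theorem sample_moment_add_le (B : X → A → A → PMF Bool) {f : X → A → A → ℝ}
    (hf : ∀ x a0 a1, |f x a0 a1| ≤ 1) {s : ℝ} (hs : 0 ≤ s) (hs1 : s ≤ 1 / 32) :
    ∑' z, corruptedSample ρ πref r α B z * ENNReal.ofReal (Real.exp (-s *
        ((f z.1 z.2.1 z.2.2.1 - signLabel z.2.2.2) ^ 2 -
          (bayesPrediction r z.1 z.2.1 z.2.2.1 - signLabel z.2.2.2) ^ 2))) +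
      ENNReal.ofReal (s / 2) * predictionError ρ πref f (bayesPrediction r) ≤
      ENNReal.ofReal (1 + 8 * s * α) := by
  unfold corruptedSample predictionError
  simp only [tsum_bind_mul, tsum_map_mul]
  simp only [← ENNReal.tsum_mul_left (a := ENNReal.ofReal (s / 2)),
    mul_left_comm (ENNReal.ofReal (s / 2)), ← ENNReal.tsum_add, ← mul_add]
  refine tsum_mul_le _ fun x => tsum_mul_le _ fun a0 => tsum_mul_le _ fun a1 => ?_
  obtain ⟨b, hb⟩ := exists_tsum_bool_mul (B x a0 a1)
  unfold huber
  rw [tsum_bind_mul, tsum_ber_mul, cond_true, cond_false, hb, tsum_ber_mul]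
  have hα := α.2
  have hp := (btProb (r x a1) (r x a0)).2
  have hα' : (0 : ℝ) ≤ 1 - α := sub_nonneg.2 hα.2
  have hb' : (0 : ℝ) ≤ 1 - b := sub_nonneg.2 b.2.2
  have hp' : (0 : ℝ) ≤ 1 - btProb (r x a1) (r x a0) := sub_nonneg.2 hp.2
  have h := label_moment_le (hf x a0 a1) hp.1 hp.2 hα.1 hα.2 b.2.1 b.2.2 hs hs1
  refine le_trans (le_of_eq ?_) (ENNReal.ofReal_le_ofReal h)
  have hα0 := hα.1
  have hb0 := b.2.1
  have hp0 := hp.1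
  simp only [signLabel, cond_true, cond_false, bayesPrediction]
  rw [ENNReal.ofReal_add (by positivity) (by positivity),
    ENNReal.ofReal_add (by positivity) (by positivity), ENNReal.ofReal_mul hα.1,
    ENNReal.ofReal_mul hα', ENNReal.ofReal_add (by positivity) (by positivity),
    ENNReal.ofReal_add (by positivity) (by positivity), ENNReal.ofReal_mul b.2.1,
    ENNReal.ofReal_mul hb', ENNReal.ofReal_mul hp.1, ENNReal.ofReal_mul hp',
    ENNReal.ofReal_mul (by positivity : 0 ≤ s / 2)]

theorem sample_moment_le (B : X → A → A → PMF Bool) {f : X → A → A → ℝ}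
    (hf : ∀ x a0 a1, |f x a0 a1| ≤ 1) {s : ℝ} (hs : 0 ≤ s) (hs1 : s ≤ 1 / 32) :
    ∑' z, corruptedSample ρ πref r α B z * ENNReal.ofReal (Real.exp (-s *
        ((f z.1 z.2.1 z.2.2.1 - signLabel z.2.2.2) ^ 2 -
          (bayesPrediction r z.1 z.2.1 z.2.2.1 - signLabel z.2.2.2) ^ 2))) ≤
      ENNReal.ofReal (Real.exp (8 * s * α -
        s / 2 * (predictionError ρ πref f (bayesPrediction r)).toReal)) := by
  have h := sample_moment_add_le ρ πref r α B hf hs hs1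
  have htop := predictionError_ne_top ρ πref hf r
  refine (ENNReal.le_sub_of_add_le_right (ENNReal.mul_ne_top ENNReal.ofReal_ne_top htop) h).trans ?_
  rw [← ENNReal.ofReal_toReal htop, ← ENNReal.ofReal_mul (by positivity),
    ← ENNReal.ofReal_sub _ (by positivity), ENNReal.toReal_ofReal ENNReal.toReal_nonneg]
  refine ENNReal.ofReal_le_ofReal ?_
  linarith [Real.add_one_le_exp (8 * s * α -
        s / 2 * (predictionError ρ πref f (bayesPrediction r)).toReal)]

/-- Independence factors the moment over the samples; the bound for one sample does not depend on
its bad-label law, so these laws may vary with `i`. -/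
theorem data_moment_le {n : ℕ} (B : Fin n → X → A → A → PMF Bool) {f : X → A → A → ℝ}
    (hf : ∀ x a0 a1, |f x a0 a1| ≤ 1) {s : ℝ} (hs : 0 ≤ s) (hs1 : s ≤ 1 / 32) :
    ∑' D, corruptedData ρ πref r α B D * ENNReal.ofReal (Real.exp (-s * ∑ i,
        ((f (D i).1 (D i).2.1 (D i).2.2.1 - signLabel (D i).2.2.2) ^ 2 -
          (bayesPrediction r (D i).1 (D i).2.1 (D i).2.2.1 - signLabel (D i).2.2.2) ^ 2))) ≤
      ENNReal.ofReal (Real.exp (n * (8 * s * α -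
        s / 2 * (predictionError ρ πref f (bayesPrediction r)).toReal))) := by
  have hprod : ∀ D : Fin n → Sample X A, corruptedData ρ πref r α B D *
      ENNReal.ofReal (Real.exp (-s * ∑ i,
        ((f (D i).1 (D i).2.1 (D i).2.2.1 - signLabel (D i).2.2.2) ^ 2 -
          (bayesPrediction r (D i).1 (D i).2.1 (D i).2.2.1 - signLabel (D i).2.2.2) ^ 2))) =
      ∏ i, corruptedSample ρ πref r α (B i) (D i) * ENNReal.ofReal (Real.exp (-s *
        ((f (D i).1 (D i).2.1 (D i).2.2.1 - signLabel (D i).2.2.2) ^ 2 -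
          (bayesPrediction r (D i).1 (D i).2.1 (D i).2.2.1 - signLabel (D i).2.2.2) ^ 2))) := by
    intro D
    rw [Finset.mul_sum, Real.exp_sum, ENNReal.ofReal_prod_of_nonneg fun i _ => (Real.exp_pos _).le,
      Finset.prod_mul_distrib]
    rfl
  rw [tsum_congr hprod, tsum_pi_prod_eq_prod_tsum fun i z =>
    corruptedSample ρ πref r α (B i) z * ENNReal.ofReal (Real.exp (-s *
        ((f z.1 z.2.1 z.2.2.1 - signLabel z.2.2.2) ^ 2 -
          (bayesPrediction r z.1 z.2.1 z.2.2.1 - signLabel z.2.2.2) ^ 2)))]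
  refine (Finset.prod_le_prod' fun i _ => sample_moment_le ρ πref r α (B i) hf hs hs1).trans ?_
  rw [Finset.prod_const, Finset.card_univ, Fintype.card_fin, ← ENNReal.ofReal_pow (Real.exp_pos _).le,
    ← Real.exp_nat_mul]

end moments

/-! ### Utility of the exponential mechanism -/

/-- The normaliser is at least the weight of `π'` alone. If `L π` is the larger loss, ε/8 may be
lowered to `s`; otherwise the bound is at least 1. Lowering the rate is needed because the moment
bounds require s ≤ 1/32 even when ε is large. -/
theorem expMechanism_le_exp {P : Type w} {F : Finset P} (hF : F.Nonempty) {ε s : ℝ} (hs : 0 ≤ s)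
    (hsε : s ≤ ε / 8) (L : P → ℝ) {π' : P} (hπ' : π' ∈ F) (π : F) :
    expMechanism F hF ε L π ≤ ENNReal.ofReal (Real.exp (-s * (L π - L π'))) := by
  rcases le_total (L π') (L π) with h | h
  · have hle : ENNReal.ofReal (Real.exp (-(ε / 8) * L π')) ≤
        ∑ π : F, ENNReal.ofReal (Real.exp (-(ε / 8) * L π)) :=
      Finset.single_le_sum (f := fun π : F => ENNReal.ofReal (Real.exp (-(ε / 8) * L π)))
        (fun _ _ => zero_le) (Finset.mem_univ ⟨π', hπ'⟩)
    unfold expMechanism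
    rw [PMF.normalize_apply, tsum_fintype]
    calc ENNReal.ofReal (Real.exp (-(ε / 8) * L π)) *
          (∑ π : F, ENNReal.ofReal (Real.exp (-(ε / 8) * L π)))⁻¹
        ≤ ENNReal.ofReal (Real.exp (-(ε / 8) * L π)) *
          (ENNReal.ofReal (Real.exp (-(ε / 8) * L π')))⁻¹ := by gcongr
      _ = ENNReal.ofReal (Real.exp (-(ε / 8) * (L π - L π'))) := by
          rw [← ENNReal.ofReal_inv_of_pos (Real.exp_pos _), ← Real.exp_neg,
            ← ENNReal.ofReal_mul (Real.exp_pos _).le, ← Real.exp_add]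
          congr 2
          ring
      _ ≤ _ := ENNReal.ofReal_le_ofReal (Real.exp_le_exp.2 (by nlinarith))
  · refine (PMF.coe_le_one _ _).trans ?_
    rw [ENNReal.one_le_ofReal, Real.one_le_exp_iff]
    nlinarith

/-- Given the data, each `π` is output with probability at most the exponential of -s times its
excess loss over `π'`, which predicts the Bayes label. Averaging over the data gives exactly the
moment of `data_moment_le`, so no separate concentration of the empirical loss is needed. -/
theorem prob_predictionError_gt_le {n : ℕ} (ρ : PMF X) (πref : Policy X A) (r : X → A → ℝ)
    (α : unitInterval) (B : Fin n → X → A → A → PMF Bool) {Rmax β ε s : ℝ}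
    {F : Finset (Policy X A)} (hF : F.Nonempty) {π' : Policy X A} (hπ' : π' ∈ F)
    (hpred : prediction πref Rmax β π' = bayesPrediction r) (hs : 0 ≤ s) (hs1 : s ≤ 1 / 32)
    (hsε : s ≤ ε / 8) (T : ℝ) :
    prob ((corruptedData ρ πref r α B).bind (squareChiPO πref Rmax β ε F hF))
      {π | T < (predictionError ρ πref (prediction πref Rmax β π) (bayesPrediction r)).toReal} ≤
      F.card * ENNReal.ofReal (Real.exp (n * (8 * s * α - s / 2 * T))) := by
  classical
  set S : Set F :=
    {π | T < (predictionError ρ πref (prediction πref Rmax β π) (bayesPrediction r)).toReal}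
  have hL : ∀ (D : Fin n → Sample X A) (π : F),
      squareLoss πref Rmax β D π - squareLoss πref Rmax β D π' = ∑ i,
        ((prediction πref Rmax β π (D i).1 (D i).2.1 (D i).2.2.1 - signLabel (D i).2.2.2) ^ 2 -
          (bayesPrediction r (D i).1 (D i).2.1 (D i).2.2.1 - signLabel (D i).2.2.2) ^ 2) := by
    intro D π
    rw [squareLoss_eq, squareLoss_eq, hpred, Finset.sum_sub_distrib]
  unfold prob
  rw [PMF.toOuterMeasure_bind_apply]
  calc ∑' D, corruptedData ρ πref r α B D *
        (squareChiPO πref Rmax β ε F hF D).toOuterMeasure S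
      ≤ ∑' D, corruptedData ρ πref r α B D * ∑ π : F, S.indicator (fun π : F =>
          ENNReal.ofReal (Real.exp (-s *
            (squareLoss πref Rmax β D π - squareLoss πref Rmax β D π')))) π := by
        refine ENNReal.tsum_le_tsum fun D => mul_le_mul_right ?_ _
        rw [PMF.toOuterMeasure_apply_fintype]
        exact Finset.sum_le_sum fun π _ => Set.indicator_le_indicator
          (expMechanism_le_exp hF hs hsε _ hπ' π)
    _ = ∑ π : F, S.indicator (fun π : F => ∑' D, corruptedData ρ πref r α B D *
          ENNReal.ofReal (Real.exp (-s *
            (squareLoss πref Rmax β D π - squareLoss πref Rmax β D π')))) π := by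
        simp only [Finset.mul_sum]
        rw [Summable.tsum_finsetSum fun _ _ => ENNReal.summable]
        refine Finset.sum_congr rfl fun π _ => ?_
        by_cases hπ : π ∈ S
        · simp only [Set.indicator_of_mem hπ]
        · simp only [Set.indicator_of_notMem hπ, mul_zero, tsum_zero]
    _ ≤ ∑ π : F, ENNReal.ofReal (Real.exp (n * (8 * s * α - s / 2 * T))) := by
        refine Finset.sum_le_sum fun π _ => ?_
        by_cases hπ : π ∈ S
        · rw [Set.indicator_of_mem hπ]
          simp only [hL]
          refine (data_moment_le ρ πref r α B (f := prediction πref Rmax β π)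
            (fun _ _ _ => abs_two_mul_sigmoid_sub_one_le _) hs hs1).trans ?_
          refine ENNReal.ofReal_le_ofReal (Real.exp_le_exp.2 ?_)
          have : T < _ := hπ
          gcongr
        · rw [Set.indicator_of_notMem hπ]
          exact zero_le
    _ = _ := by simp

/-! ### Utility of the algorithm -/

theorem sigmoid_sub_eq_btProb (s t : ℝ) : Real.sigmoid (s - t) = (btProb s t : ℝ) := by
  rw [Real.sigmoid_def, neg_sub, Real.exp_sub]
  unfold btProb
  field_simp

theorem bayesPrediction_eq (r : X → A → ℝ) (x : X) (a0 a1 : A) :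
    bayesPrediction r x a0 a1 = 2 * Real.sigmoid (r x a1 - r x a0) - 1 := by
  rw [sigmoid_sub_eq_btProb]
  rfl

/-- Average 2u ≤ u² + 1 under `πref`, where u is the density ratio, of mean 1. -/
theorem one_le_concentrability (ρ : PMF X) {πref : Policy X A} (href : ∀ x a, 0 < πref x a)
    (π : Policy X A) : 1 ≤ concentrability ρ πref π := by
  have hx : ∀ x, 1 ≤ ∑' a, π x a * ratio πref π x a := by
    intro x
    have h : ∀ a, 2 * π x a ≤ π x a * ratio πref π x a + πref x a := by
      intro a
      have hq : π x a = πref x a * ratio πref π x a :=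
        (ENNReal.mul_div_cancel (href x a).ne' ((πref x).apply_ne_top a)).symm
      have hu : 2 * ratio πref π x a ≤ ratio πref π x a * ratio πref π x a + 1 := by
        lift ratio πref π x a to NNReal using ratio_ne_top href x a with u
        norm_cast
        rw [← NNReal.coe_le_coe]
        push_cast
        nlinarith [sq_nonneg ((u : ℝ) - 1)]
      rw [hq]
      calc 2 * (πref x a * ratio πref π x a) = πref x a * (2 * ratio πref π x a) := by ring
        _ ≤ πref x a * (ratio πref π x a * ratio πref π x a + 1) := by gcongr
        _ = _ := by ring
    have h2 := ENNReal.tsum_le_tsum h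
    rw [ENNReal.tsum_mul_left, ENNReal.tsum_add, (π x).tsum_coe, (πref x).tsum_coe, mul_one,
      ← one_add_one_eq_two] at h2
    exact (ENNReal.add_le_add_iff_right ENNReal.one_ne_top).1 h2
  calc (1 : ℝ≥0∞) = ∑' x, ρ x * 1 := by simp [ρ.tsum_coe]
    _ ≤ _ := ENNReal.tsum_le_tsum fun x => mul_le_mul_right (hx x) _

section utility
variable {ρ : PMF X} {πref : Policy X A} {r : X → A → ℝ} {Rmax Vmax β : ℝ}
  {F : Finset (Policy X A)}

/-- The first-order condition identifies the implicit reward differences with the true ones. These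
are at most `Rmax` in absolute value, so the clipping at 2 Rmax is inactive. -/
theorem IsRegularizedOptimal.prediction_eq_bayesPrediction {π : Policy X A}
    (hπ : IsRegularizedOptimal ρ r πref β π) (hβ : 0 < β) (hρ : ∀ x, 0 < ρ x)
    (href : ∀ x a, 0 < πref x a) (hr : ∀ x a, 0 ≤ r x a ∧ r x a ≤ Rmax)
    (hpos : ∀ x a, 0 < π x a) : prediction πref Rmax β π = bayesPrediction r := by
  have hr' : ∀ x a, |r x a| ≤ Rmax := fun x a => by
    rw [abs_of_nonneg (hr x a).1]
    exact (hr x a).2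
  ext x a0 a1
  have hfoc := hπ.reward_sub_eq hβ href hr' (hρ x) (hpos x) a1 a0
  change _ = β * (realPhi πref π x a1 - realPhi πref π x a0) at hfoc
  rw [prediction_eq href Rmax (hpos x a0) (hpos x a1), bayesPrediction_eq, ← hfoc,
    min_eq_left (by linarith [(hr x a0).1, (hr x a0).2, (hr x a1).1, (hr x a1).2]),
    max_eq_left (by linarith [(hr x a0).1, (hr x a0).2, (hr x a1).1, (hr x a1).2])]

theorem BoundedImplicitReward.reward_error_le (hF : BoundedImplicitReward πref β Vmax F)
    (hβ : 0 < β) (hR : 0 < Rmax) (hRV : Rmax ≤ Vmax) (href : ∀ x a, 0 < πref x a)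
    (hr : ∀ x a, 0 ≤ r x a ∧ r x a ≤ Rmax) {π : Policy X A} (hπ : π ∈ F) :
    (∑' x, ρ x * ∑' a0, πref x a0 * ∑' a1, πref x a1 * ENNReal.ofReal
      (((r x a1 - r x a0) - β * (realPhi πref π x a1 - realPhi πref π x a0)) ^ 2)) ≤
      ENNReal.ofReal ((4 * Real.exp (2 * Rmax) * (Vmax / Rmax)) ^ 2) *
        predictionError ρ πref (prediction πref Rmax β π) (bayesPrediction r) := by
  unfold predictionError
  simp only [← ENNReal.tsum_mul_left (a := ENNReal.ofReal ((4 * _ * _) ^ 2)),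
    mul_left_comm (ENNReal.ofReal ((4 * _ * _) ^ 2))]
  refine ENNReal.tsum_le_tsum fun x => mul_le_mul_right (ENNReal.tsum_le_tsum fun a0 =>
    mul_le_mul_right (ENNReal.tsum_le_tsum fun a1 => mul_le_mul_right ?_ _) _) _
  rw [← ENNReal.ofReal_mul (sq_nonneg _), ← mul_pow]
  refine ENNReal.ofReal_le_ofReal (sq_le_sq.2 ?_)
  have h := abs_sub_le_of_clip hR hRV (hF.abs_reward_sub_le hβ (hR.le.trans hRV) href hπ x a1 a0)
    (e := r x a1 - r x a0) (abs_le.2 ⟨by linarith [(hr x a1).1, (hr x a0).2],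
      by linarith [(hr x a1).2, (hr x a0).1]⟩)
  rw [← bayesPrediction_eq, ← prediction_eq href Rmax (hF.pos hβ hπ x a0) (hF.pos hβ hπ x a1)] at h
  have hV : 0 ≤ Vmax := hR.le.trans hRV
  rwa [abs_mul, abs_of_nonneg (by positivity : 0 ≤ 4 * Real.exp (2 * Rmax) * (Vmax / Rmax))]

/-- A policy with small prediction error has a small suboptimality gap, if `β` is tuned. -/
theorem gap_le_of_predictionError_le (hF : BoundedImplicitReward πref β Vmax F)
    (hR : 0 < Rmax) (hRV : Rmax ≤ Vmax) (href : ∀ x a, 0 < πref x a)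
    (hr : ∀ x a, 0 ≤ r x a ∧ r x a ≤ Rmax) {π πstar : Policy X A} (hπ : π ∈ F) {C T : ℝ}
    (hC : 1 ≤ C) (hconc : concentrability ρ πref πstar = ENNReal.ofReal C) (hT : 0 < T)
    (hβ : β = 4 * Real.exp (2 * Rmax) * (Vmax / Rmax) * Real.sqrt T / Real.sqrt C)
    (herr : (predictionError ρ πref (prediction πref Rmax β π) (bayesPrediction r)).toReal ≤ T) :
    gap ρ r πstar π ≤ 16 * kappa Rmax Vmax C * Real.sqrt T := by
  have hV : 0 < Vmax := hR.trans_le hRV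
  set k := 4 * Real.exp (2 * Rmax) * (Vmax / Rmax) with hk
  have hk0 : 0 < k := by positivity
  have hC0 : 0 < Real.sqrt C := Real.sqrt_pos.2 (by linarith)
  have hC1 : 1 ≤ Real.sqrt C := Real.one_le_sqrt.2 hC
  have hT0 : 0 < Real.sqrt T := Real.sqrt_pos.2 hT
  have hβ0 : 0 < β := by rw [hβ]; positivity
  have htop := predictionError_ne_top ρ πref (f := prediction πref Rmax β π)
    (fun _ _ _ => abs_two_mul_sigmoid_sub_one_le _) r
  have hr' : ∀ x a, |r x a| ≤ Rmax := fun x a => by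
    rw [abs_of_nonneg (hr x a).1]
    exact (hr x a).2
  have h := ofReal_gap_le (ρ := ρ) (πstar := πstar) href (hF.pos hβ0 hπ) hr' hβ0
  have h2 : ENNReal.ofReal (gap ρ r πstar π) ≤
      ENNReal.ofReal (1 / β * (k ^ 2 * T) + 2 * β * C + β) := by
    refine h.trans ?_
    rw [hconc, ENNReal.ofReal_add (by positivity) hβ0.le,
      ENNReal.ofReal_add (by positivity) (by positivity),
      ENNReal.ofReal_mul (p := 1 / β) (by positivity), ENNReal.ofReal_mul (p := k ^ 2) (by positivity),
      ENNReal.ofReal_mul (p := 2 * β) (by positivity)]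
    gcongr
    refine (hF.reward_error_le hβ0 hR hRV href hr hπ).trans ?_
    gcongr
    exact (ENNReal.le_ofReal_iff_toReal_le htop hT.le).2 herr
  rw [ENNReal.ofReal_le_ofReal_iff (by positivity)] at h2
  refine h2.trans ?_
  have hCC : C = Real.sqrt C * Real.sqrt C := (Real.mul_self_sqrt (by linarith)).symm
  have hTT : T = Real.sqrt T * Real.sqrt T := (Real.mul_self_sqrt hT.le).symm
  -- With this β the three terms are k√(TC), 2k√(TC) and, as C ≥ 1, at most k√(TC). Their sum
  -- 4k√(TC) is 16 κ √T, the factor 4 in `k` included.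
  have e1 : 1 / β * (k ^ 2 * T) = k * Real.sqrt T * Real.sqrt C := by
    rw [hβ]
    nth_rewrite 2 [hTT]
    field_simp
  have e2 : 2 * β * C = 2 * (k * Real.sqrt T * Real.sqrt C) := by
    rw [hβ]
    nth_rewrite 2 [hCC]
    field_simp
  have e3 : β ≤ k * Real.sqrt T * Real.sqrt C := by
    rw [hβ]
    calc k * Real.sqrt T / Real.sqrt C ≤ k * Real.sqrt T := div_le_self (by positivity) hC1
      _ ≤ _ := le_mul_of_one_le_right (by positivity) hC1
  have e4 : 16 * kappa Rmax Vmax C * Real.sqrt T = 4 * (k * Real.sqrt T * Real.sqrt C) := by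
    rw [hk]
    unfold kappa
    ring
  linarith

end utility

/-! ### Choice of the error level and the final rate -/

/-- The rate of the exponential moment bound. -/
def momentRate (ε : ℝ) : ℝ := min (1 / 32) (ε / 8)

/-- High-probability bound on the prediction error of the output. -/
def errorBound (ε ζ α : ℝ) (n N : ℕ) : ℝ :=
  16 * α + 2 / (n * momentRate ε) * Real.log (N / ζ)

theorem momentRate_pos {ε : ℝ} (hε : 0 < ε) : 0 < momentRate ε :=
  lt_min (by norm_num) (by positivity)

theorem log_div_pos {ζ : ℝ} {N : ℕ} (hζ : 0 < ζ) (hζ1 : ζ < 1) (hN : 0 < N) :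
    0 < Real.log (N / ζ) := by
  refine Real.log_pos ((one_lt_div hζ).2 (hζ1.trans_le ?_))
  exact_mod_cast hN

theorem errorBound_pos {ε ζ α : ℝ} {n N : ℕ} (hε : 0 < ε) (hζ : 0 < ζ) (hζ1 : ζ < 1)
    (hα : 0 ≤ α) (hn : 0 < n) (hN : 0 < N) : 0 < errorBound ε ζ α n N := by
  have h1 := momentRate_pos hε
  have h2 := log_div_pos hζ hζ1 hN
  have h3 : (0 : ℝ) < n := by exact_mod_cast hn
  unfold errorBound
  positivity

/-- `errorBound` is the level T at which the bound of `prob_predictionError_gt_le` equals ζ: the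
term 16α cancels the corruption, and the rest leaves -log(N/ζ) in the exponent. -/
theorem card_mul_exp_errorBound {ε ζ α : ℝ} {n N : ℕ} (hε : 0 < ε) (hζ : 0 < ζ) (hn : 0 < n)
    (hN : 0 < N) : (N : ℝ) * Real.exp (n * (8 * momentRate ε * α -
      momentRate ε / 2 * errorBound ε ζ α n N)) = ζ := by
  have h1 := momentRate_pos hε
  have h3 : (0 : ℝ) < n := by exact_mod_cast hn
  have h4 : (0 : ℝ) < N := by exact_mod_cast hN
  have e : n * (8 * momentRate ε * α - momentRate ε / 2 * errorBound ε ζ α n N) =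
      -Real.log (N / ζ) := by
    unfold errorBound
    field_simp
    ring
  rw [e, Real.exp_neg, Real.exp_log (by positivity)]
  field_simp

/-- The inverse rate is max(32, 8/ε) ≤ 32(1 + 1/ε), so the error is at most 16α + 64(1 + 1/ε)
log(N/ζ)/n. Expanding the square of the right side yields these terms, with coefficient 64. -/
theorem sqrt_errorBound_le {ε ζ α : ℝ} {n N : ℕ} (hε : 0 < ε) (hζ : 0 < ζ) (hζ1 : ζ < 1)
    (hα : 0 ≤ α) (hn : 0 < n) (hN : 0 < N) :
    Real.sqrt (errorBound ε ζ α n N) ≤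
      8 * ((1 + 1 / Real.sqrt ε) * Real.sqrt (Real.log (N / ζ) / n) + Real.sqrt α) := by
  have h1 := momentRate_pos hε
  have h2 := log_div_pos hζ hζ1 hN
  have h3 : (0 : ℝ) < n := by exact_mod_cast hn
  have hs : 0 < Real.sqrt ε := Real.sqrt_pos.2 hε
  have hrate : 1 / momentRate ε ≤ 32 * (1 + 1 / ε) := by
    unfold momentRate
    rcases min_choice (1 / 32 : ℝ) (ε / 8) with h | h <;> rw [h]
    · have : 0 < 1 / ε := by positivity
      norm_num
      positivity
    · rw [one_div_div]
      have : 0 < 1 / ε := by positivity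
      rw [div_eq_mul_one_div]
      linarith
  refine Real.sqrt_le_iff.2 ⟨by positivity, ?_⟩
  set l := Real.sqrt (Real.log (N / ζ) / n) with hl
  have hl2 : l ^ 2 = Real.log (N / ζ) / n := Real.sq_sqrt (by positivity)
  have hα2 : Real.sqrt α ^ 2 = α := Real.sq_sqrt hα
  have hε2 : (1 / Real.sqrt ε) ^ 2 = 1 / ε := by rw [div_pow, Real.sq_sqrt hε.le, one_pow]
  have e : errorBound ε ζ α n N = 16 * Real.sqrt α ^ 2 + 2 * (1 / momentRate ε) * l ^ 2 := by
    unfold errorBound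
    rw [hl2, hα2]
    field_simp
  have hle : 2 * (1 / momentRate ε) * l ^ 2 ≤ 64 * (1 + (1 / Real.sqrt ε) ^ 2) * l ^ 2 := by
    rw [hε2]
    exact mul_le_mul_of_nonneg_right (by linarith) (sq_nonneg l)
  have hl0 : 0 ≤ l := Real.sqrt_nonneg _
  have hα0 := Real.sqrt_nonneg α
  have hi : 0 < 1 / Real.sqrt ε := by positivity
  rw [e]
  refine (add_le_add_right hle _).trans ?_
  have x1 : 0 ≤ (1 / Real.sqrt ε) * l ^ 2 := by positivity
  have x2 : 0 ≤ (1 + 1 / Real.sqrt ε) * l * Real.sqrt α := by positivity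
  nlinarith [sq_nonneg (Real.sqrt α)]

theorem one_sub_le_prob {Ω : Type*} (q : PMF Ω) {S S' : Set Ω} (h : Sᶜ ⊆ S') {ζ : ℝ}
    (hζ : 0 ≤ ζ) (hS : prob q S' ≤ ENNReal.ofReal ζ) : ENNReal.ofReal (1 - ζ) ≤ prob q S := by
  have hcover : (1 : ℝ≥0∞) ≤ prob q S + prob q S' := by
    calc (1 : ℝ≥0∞) = q.toOuterMeasure (Set.univ) := by
          rw [PMF.toOuterMeasure_apply, Set.indicator_univ, q.tsum_coe]
      _ ≤ q.toOuterMeasure (S ∪ S') := by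
          refine MeasureTheory.measure_mono fun z _ => ?_
          by_cases hz : z ∈ S
          · exact Or.inl hz
          · exact Or.inr (h hz)
      _ ≤ _ := MeasureTheory.measure_union_le S S'
  rw [ENNReal.ofReal_sub _ hζ, ENNReal.ofReal_one]
  exact tsub_le_iff_right.2 (hcover.trans (by gcongr))

theorem squareChiPO_utility {ρ : PMF X} {πref πstar : Policy X A} {r : X → A → ℝ}
    {Rmax Vmax ε ζ C β : ℝ} {α : unitInterval} {n : ℕ} {F : Finset (Policy X A)}
    (hF : F.Nonempty) (hR : 0 < Rmax) (hRV : Rmax ≤ Vmax) (hε : 0 < ε) (hζ : 0 < ζ) (hζ1 : ζ < 1)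
    (hn : 0 < n) (hC : 1 ≤ C)
    (hβ : β = 4 * Real.exp (2 * Rmax) * (Vmax / Rmax) *
      Real.sqrt (errorBound ε ζ α n F.card) / Real.sqrt C)
    (hρ : ∀ x, 0 < ρ x) (href : ∀ x a, 0 < πref x a) (hr : ∀ x a, 0 ≤ r x a ∧ r x a ≤ Rmax)
    (hconc : concentrability ρ πref πstar = ENNReal.ofReal C)
    (hreal : Realizable ρ r πref β F) (hbdd : BoundedImplicitReward πref β Vmax F)
    (B : Fin n → X → A → A → PMF Bool) :
    ENNReal.ofReal (1 - ζ) ≤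
      prob ((corruptedData ρ πref r α B).bind (squareChiPO πref Rmax β ε F hF))
        {πhat | gap ρ r πstar πhat ≤ 128 * (kappa Rmax Vmax C *
          ((1 + 1 / Real.sqrt ε) * Real.sqrt (Real.log (F.card / ζ) / n) + Real.sqrt α))} := by
  have hV : 0 < Vmax := hR.trans_le hRV
  have hN : 0 < F.card := hF.card_pos
  have hT : 0 < errorBound ε ζ α n F.card := errorBound_pos hε hζ hζ1 α.2.1 hn hN
  have hC0 : 0 < Real.sqrt C := Real.sqrt_pos.2 (by linarith)
  have hT0 := Real.sqrt_pos.2 hT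
  have hβ0 : 0 < β := by rw [hβ]; positivity
  obtain ⟨π', hπ', hopt⟩ := hreal
  have hpred := hopt.prediction_eq_bayesPrediction hβ0 hρ href hr (hbdd.pos hβ0 hπ')
  have hbad := prob_predictionError_gt_le ρ πref r α B hF hπ' hpred (momentRate_pos hε).le
    (min_le_left _ _) (min_le_right _ _) (errorBound ε ζ α n F.card)
  rw [← ENNReal.ofReal_natCast, ← ENNReal.ofReal_mul (Nat.cast_nonneg _),
    card_mul_exp_errorBound hε hζ hn hN] at hbad
  refine one_sub_le_prob _ (fun π hπ => ?_) hζ.le hbad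
  -- Off the bad event the prediction error is at most `errorBound`, so the gap bound applies; the
  -- constants multiply to 16 · 8 = 128.
  by_contra hnot
  refine hπ ((gap_le_of_predictionError_le hbdd hR hRV href hr π.2 hC hconc hT hβ
    (not_lt.1 hnot)).trans ?_)
  have hκ : 0 ≤ kappa Rmax Vmax C := by
    unfold kappa
    positivity
  calc 16 * kappa Rmax Vmax C * Real.sqrt (errorBound ε ζ α n F.card)
      ≤ 16 * kappa Rmax Vmax C * (8 * ((1 + 1 / Real.sqrt ε) *
        Real.sqrt (Real.log (F.card / ζ) / n) + Real.sqrt α)) := by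
        gcongr
        exact sqrt_errorBound_le hε hζ hζ1 α.2.1 hn hN
    _ = _ := by ring

end SquareChiPO

end

theorem theorem2 :
    -- privacy, for every number of samples, class, regularization and clipping level
    (∀ (X : Type u) (A : Type v) (n : ℕ) (πref : SquareChiPO.Policy X A) (Rmax β ε : ℝ)
        (F : Finset (SquareChiPO.Policy X A)) (hF : F.Nonempty), 0 < ε →
      SquareChiPO.IsDP ε
        (fun D : Fin n → SquareChiPO.Sample X A =>
          SquareChiPO.squareChiPO πref Rmax β ε F hF D)) ∧
    -- utility, with a universal constant `c`
    (∃ c : ℝ, 0 < c ∧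
      ∀ (Rmax Vmax ε ζ C : ℝ) (α : unitInterval) (n N : ℕ),
        0 < Rmax → Rmax ≤ Vmax → 0 < ε → 0 < ζ → ζ ≤ 1 → (α : ℝ) ≤ 1 / 2 → 0 < n →
      -- `β` depends on these parameters only; `C` is the concentrability of the comparator,
      -- `N` is the size of the policy class
      ∃ β : ℝ, 0 < β ∧
        ∀ (X : Type u) (A : Type v) (ρ : PMF X) (πref : SquareChiPO.Policy X A)
          (r : X → A → ℝ) (πstar : SquareChiPO.Policy X A),
          (∀ x, 0 < ρ x) → (∀ x a, 0 < πref x a) → (∀ x a, 0 ≤ r x a ∧ r x a ≤ Rmax) →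
          SquareChiPO.concentrability ρ πref πstar = ENNReal.ofReal C →
        ∀ (F : Finset (SquareChiPO.Policy X A)) (hF : F.Nonempty), F.card = N →
          SquareChiPO.Realizable ρ r πref β F →
          SquareChiPO.BoundedImplicitReward πref β Vmax F →
        ∀ B : Fin n → X → A → A → PMF Bool,
          ENNReal.ofReal (1 - ζ) ≤
            SquareChiPO.prob
              ((SquareChiPO.corruptedData ρ πref r α B).bind
                (SquareChiPO.squareChiPO πref Rmax β ε F hF))
              {πhat | SquareChiPO.gap ρ r πstar πhat ≤
                c * (SquareChiPO.kappa Rmax Vmax C *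
                  ((1 + 1 / Real.sqrt ε) * Real.sqrt (Real.log (N / ζ) / n)
                    + Real.sqrt α))}) := by
  refine ⟨fun X A n πref Rmax β ε F hF hε => SquareChiPO.squareChiPO_isDP πref Rmax β F hF hε,
    128, by norm_num, fun Rmax Vmax ε ζ C α n N hR hRV hε hζ hζ1 hα hn => ?_⟩
  -- β is fixed before the class and the comparator, so degenerate parameters must be treated too.
  -- For ζ = 1, N = 1 and α = 0 the tuned β would vanish, but any bound holds with probability at
  -- least 1 - ζ = 0. The cases N = 0 and C < 1 cannot occur for an actual class and comparator.
  -- Hence any positive β serves.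
  by_cases hcase : ζ < 1 ∧ 0 < N ∧ 1 ≤ C
  · obtain ⟨hζ1, hN, hC⟩ := hcase
    have hT := Real.sqrt_pos.2 (SquareChiPO.errorBound_pos (α := α) hε hζ hζ1 α.2.1 hn hN)
    have hC0 : 0 < Real.sqrt C := Real.sqrt_pos.2 (by linarith)
    have hV : 0 < Vmax := hR.trans_le hRV
    refine ⟨4 * Real.exp (2 * Rmax) * (Vmax / Rmax) *
      Real.sqrt (SquareChiPO.errorBound ε ζ α n N) / Real.sqrt C, by positivity, ?_⟩
    rintro X A ρ πref r πstar hρ href hr hconc F hF rfl hreal hbdd B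
    exact SquareChiPO.squareChiPO_utility hF hR hRV hε hζ hζ1 hn hC rfl hρ href hr hconc hreal
      hbdd B
  · refine ⟨1, one_pos, fun X A ρ πref r πstar hρ href hr hconc F hF hN hreal hbdd B => ?_⟩
    have hN0 : 0 < N := hN ▸ hF.card_pos
    have hC : 1 ≤ C := by
      have := SquareChiPO.one_le_concentrability ρ href πstar
      rwa [hconc, ENNReal.one_le_ofReal] at this
    have hζ2 : 1 - ζ ≤ 0 := by
      by_contra hlt
      exact hcase ⟨by linarith, hN0, hC⟩
    rw [ENNReal.ofReal_of_nonpos hζ2]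
    exact zero_le
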